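/- Let $p\ge 2$ and let $\tau:\{0,1\}\to\{0,1\}^p$ be a substitution of constant length $p$ that is one-to-one ($\tau(0)\neq\tau(1)$) and primitive (for some $n$ both letters occur in $\tau^n(0)$ and in $\tau^n(1)$). Let $X_\tau\subseteq\{0,1\}^{\mathbb Z}$ be the subshift of all sequences each of whose finite words occurs in some $\tau^n(a)$, with the shift $T$, $(Tx)_n=x_{n+1}$, and assume that $X_\tau$ is infinite. Let $\varrho$ be any metric on $X_\tau$ inducing its topology. A pair $(x,y)\in X_\tau^2$ is *distal* if $\liminf_n\varrho(T^nx,T^ny)>0$, *asymptotic* if $\lim_n\varrho(T^nx,T^ny)=0$, and a *Li–Yorke pair* if $\liminf_n\varrho(T^nx,T^ny)=0<\limsup_n\varrho(T^nx,T^ny)$. Extend $\tau$ to two-sided sequences by $\tau(x)=\dots\tau(x_{-1}).\tau(x_0)\tau(x_1)\dots$. For $x\in X_\tau$ let $(x^{(i)})_{i\ge0}$ in $X_\tau$ and $\pi(x)=(\delta_i)_{i\ge0}$ in $\{0,\dots,p-1\}$ be the unique sequences with $x^{(0)}=x$ and $\tau(x^{(i+1)})=T^{-\delta_i}x^{(i)}$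 for all $i\ge 0$ (they exist by Mossé's theorem). Put $s_i(x)=x^{(i)}_1\cdots x^{(i)}_{p-1-\delta_i}$ (the empty word if $\delta_i=p-1$) and $\mathcal I^+(x)=\{i\ge0: s_i(x)\text{ is not empty}\}$. If $\mathcal I^+(x)$ is finite, put $k^+(x)=\max\{|x_0s_0(x)\tau(s_1(x))\cdots\tau^i(s_i(x))|: i\in\mathcal I^+(x)\}$, with $k^+(x)=|x_0|=1$ if $\mathcal I^+(x)=\emptyset$. A position $i\in\{0,\dots,p-1\}$ is a *coincidence* if $\tau(0)_i=\tau(1)_i$ and a *non-coincidence* otherwise. Then: 1. Suppose that there is no coincidence, and let $x,y\in X_\tau$ with $\pi(x)=\pi(y)$. If there is $i\ge0$ such that $x_i\ne y_i$ and $\mathcal I^+(T^ix)$, $\mathcal I^+(T^iy)$ are infinite, then $(x,y)$ is distal. In any other case $(x,y)$ is asymptotic. 2. If there is a unique non-coincidence, then all $x,y\in X_\tau$ with $\pi(x)=\pi(y)$ form an asymptotic pair. 3. There exist Li–Yorke pairs in $X_\tau$ if and only if there exist a coincidence and at least two non-coincidences. Moreover, suppose that there is a coincidence, and let $x,y\in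 X_\tau$ with $\pi(x)=\pi(y)$. If $\mathcal I^+(x)$ is infinite, then $(x,y)$ is a Li–Yorke pair if and only if $s_i(x)\ne s_i(y)$ for infinitely many $i$. If $\mathcal I^+(x)$ is finite, then $(x,y)$ is a Li–Yorke pair if and only if $s_i(T^{k^+(x)}x)\ne s_i(T^{k^+(y)}y)$ for infinitely many $i$. -/

import Mathlib

open Filter Topology

namespace ConstLengthSubst

/-! ### Pairs of points of a dynamical system `(X, T)` with metric `dist`

These are used on a compact space only, so all the sequences involved are bounded. -/

section Pairs

variable {X : Type*} [MetricSpace X]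

/-- Distal pair: `liminf ϱ(Tⁿx, Tⁿy) > 0`. -/
def IsDistalPair (T : X → X) (x y : X) : Prop :=
  0 < liminf (fun n : ℕ => dist (T^[n] x) (T^[n] y)) atTop

/-- Asymptotic pair: `lim ϱ(Tⁿx, Tⁿy) = 0`. -/
def IsAsymptoticPair (T : X → X) (x y : X) : Prop :=
  Tendsto (fun n : ℕ => dist (T^[n] x) (T^[n] y)) atTop (𝓝 0)

/-- Li–Yorke pair: `limsup ϱ(Tⁿx, Tⁿy) > 0` and `liminf ϱ(Tⁿx, Tⁿy) = 0`. -/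
def IsLiYorkePair (T : X → X) (x y : X) : Prop :=
  0 < limsup (fun n : ℕ => dist (T^[n] x) (T^[n] y)) atTop ∧
    liminf (fun n : ℕ => dist (T^[n] x) (T^[n] y)) atTop = 0

end Pairs

/-! ### Substitutions of constant length

A substitution of constant length `p` on the alphabet `A` is a map `τ : A → Fin p → A`:
the word `τ(a)` has the letters `τ a 0, …, τ a (p - 1)`. -/

section Substitution

variable {A : Type*} {p : ℕ}

/-- The extension of `τ` to finite words by concatenation. -/
def onWord (τ : A → Fin p → A) (w : List A) : List A :=
  w.flatMap fun a => List.ofFn (τ a)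

/-- The word `τⁿ(a)`. -/
def iterWord (τ : A → Fin p → A) (n : ℕ) (a : A) : List A :=
  (onWord τ)^[n] [a]

/-- The extension of `τ` to two-sided sequences: `τ(x) = … τ(x₋₁) . τ(x₀) τ(x₁) …`, where
`τ(x₀)` starts at the coordinate `0` (`/` and `%` on `ℤ` round down for a positive divisor). -/
def onSeq [NeZero p] (τ : A → Fin p → A) (x : ℤ → A) : ℤ → A := fun n =>
  τ (x (n / (p : ℤ))) ⟨(n % (p : ℤ)).toNat, by
    have hp : (0 : ℤ) < p := by exact_mod_cast Nat.pos_of_ne_zero (NeZero.ne p)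
    have h1 := Int.emod_nonneg n hp.ne'
    have h2 := Int.emod_lt_of_pos n hp
    omega⟩

/-- `τ` is primitive: for some `n`, every letter appears in `τⁿ(b)` for every letter `b`. -/
def IsPrimitive (τ : A → Fin p → A) : Prop :=
  ∃ n : ℕ, ∀ a b : A, a ∈ iterWord τ n b

/-- `τ` has a coincidence: `τ(a)` and `τ(b)` have the same letter at some position, for some
letters `a ≠ b`. -/
def HasCoincidence (τ : A → Fin p → A) : Prop :=
  ∃ a b : A, a ≠ b ∧ ∃ i : Fin p, τ a i = τ b i

/-- The word of length `n` of the sequence `x` that starts at the coordinate `i`. -/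
def wordAt (x : ℤ → A) (i : ℤ) (n : ℕ) : List A :=
  (List.range n).map fun j : ℕ => x (i + (j : ℤ))

/-- The subshift `X_τ`: the two-sided sequences all of whose finite words occur in some
`τᵏ(a)`. -/
def subshift (τ : A → Fin p → A) : Set (ℤ → A) :=
  {x | ∀ (i : ℤ) (n : ℕ), ∃ (k : ℕ) (a : A), wordAt x i n <:+: iterWord τ k a}

theorem shift_mem_subshift (τ : A → Fin p → A) {x : ℤ → A} (hx : x ∈ subshift τ) :
    (fun n : ℤ => x (n + 1)) ∈ subshift τ := by
  intro i n
  obtain ⟨k, a, h⟩ := hx (i + 1) n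
  refine ⟨k, a, ?_⟩
  have e : wordAt (fun n : ℤ => x (n + 1)) i n = wordAt x (i + 1) n := by
    unfold wordAt
    refine List.map_congr_left fun j _ => ?_
    change x (i + (j : ℤ) + 1) = x (i + 1 + (j : ℤ))
    congr 1
    ring
  rw [e]
  exact h

/-- The shift `T` on `X_τ`: `(T x)ₙ = xₙ₊₁`. -/
def shift (τ : A → Fin p → A) (x : subshift τ) : subshift τ :=
  ⟨fun n : ℤ => x.1 (n + 1), shift_mem_subshift τ x.2⟩

end Substitution

/-! ### The factor map onto the odometer and the words `s_i(x)` -/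

section Odometer

variable {A : Type*} [Nonempty A] {p : ℕ} [NeZero p]

/-- The points `x⁽ⁱ⁾ = xs i` of `X_τ` and the digits `δ_i = δ i` in `{0, …, p - 1}` satisfy
`x⁽⁰⁾ = x` and `τ(x⁽ⁱ⁺¹⁾) = T^{-δ_i}(x⁽ⁱ⁾)`. -/
def IsDesubstitution (τ : A → Fin p → A) (x : ℤ → A) (xs : ℕ → ℤ → A) (δ : ℕ → Fin p) : Prop :=
  xs 0 = x ∧ (∀ i, xs i ∈ subshift τ) ∧
    ∀ i, onSeq τ (xs (i + 1)) = fun n : ℤ => xs i (n - ((δ i : ℕ) : ℤ))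

/-- The pair of sequences `(x⁽ⁱ⁾)`, `(δ_i)` attached to `x`. For a primitive `τ` with `X_τ`
infinite and `x ∈ X_τ`, exactly one pair with `IsDesubstitution` exists, by the recognizability
theorem of Mossé; `Classical.epsilon` selects it. -/
noncomputable def desubst (τ : A → Fin p → A) (x : ℤ → A) : (ℕ → ℤ → A) × (ℕ → Fin p) :=
  Classical.epsilon fun q => IsDesubstitution τ x q.1 q.2

/-- The point `x⁽ⁱ⁾`. -/
noncomputable def level (τ : A → Fin p → A) (x : ℤ → A) (i : ℕ) : ℤ → A :=
  (desubst τ x).1 i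

/-- The factor map `π` onto the `p`-odometer, whose points are written as digit sequences in
base `p`: `π(x) = (δ_i)_i`. -/
noncomputable def toOdometer (τ : A → Fin p → A) (x : ℤ → A) : ℕ → Fin p :=
  (desubst τ x).2

/-- The word `s_i(x) = x⁽ⁱ⁾(1, p - 1 - δ_i)`, empty if `δ_i = p - 1`. -/
noncomputable def sWord (τ : A → Fin p → A) (x : ℤ → A) (i : ℕ) : List A :=
  wordAt (level τ x i) 1 (p - 1 - (toOdometer τ x i : ℕ))

/-- `I⁺(x)`, the set of all `i` for which `s_i(x)` is not empty. -/
def iPlus (τ : A → Fin p → A) (x : ℤ → A) : Set ℕ :=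
  {i | (sWord τ x i).length ≠ 0}

/-- The word `x₀ s₀(x) τ(s₁(x)) ⋯ τⁱ(s_i(x))`. -/
noncomputable def rightWord (τ : A → Fin p → A) (x : ℤ → A) (i : ℕ) : List A :=
  x 0 :: (List.range (i + 1)).flatMap fun j => (onWord τ)^[j] (sWord τ x j)

/-- `k⁺(x)`, used only when `I⁺(x)` is finite: the maximum of the lengths of the words
`x₀ s₀(x) τ(s₁(x)) ⋯ τⁱ(s_i(x))` over `i ∈ I⁺(x)`, and the length `1` of the word `x₀` alone
when `I⁺(x)` is empty. -/
noncomputable def kPlus (τ : A → Fin p → A) (x : ℤ → A) : ℕ :=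
  max 1 (sSup ((fun i => (rightWord τ x i).length) '' iPlus τ x))

end Odometer

end ConstLengthSubst

open ConstLengthSubst

/-! Two points x, y of one fibre of π are cut at the same places into blocks τⁱ(a), for every i. The
origin sits at place `offset δ i` of its block of level i, and `reach δ i` coordinates of that block
remain. Comparing x and y on a block amounts to comparing one letter of x⁽ⁱ⁾ with one letter of
y⁽ⁱ⁾. If I⁺ is infinite, `reach δ i` tends to infinity, so the blocks around the origin exhaust the
right half-line. If I⁺ is finite, shifting by k⁺ is an addition with carries that makes all digits
0, which leads back to the infinite case.

Without coincidence, τⁱ(0) and τⁱ(1) differ everywhere, so one coordinate decides the whole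
half-line. With a unique non-coincidence they differ at exactly one place, so the half-line contains
at most one difference. With a coincidence, x⁽ⁱ⁾ and y⁽ⁱ⁾ share a letter to the right of the origin
for every i, so x and y agree on blocks of length pⁱ and are proximal
(`IsDesubstitution.isProximal`). Such a pair is Li–Yorke exactly when x and y differ infinitely
often on the right. For I⁺ infinite the words τⁱ(s_i) tile the half-line, which turns this into the
condition on the s_i (`IsDesubstitution.infinite_wordAt_ne_iff`).

A Li–Yorke pair is proximal, and proximal points lie in one fibre by uniform recognizability
(`IsProximal.digits_eq`), so the first two cases exclude Li–Yorke pairs. Conversely, for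
non-coincidences i < j, two points with all digits i and distinct letters at the origin of every
level differ in every s_n.

Recognizability is derived from minimality. If Tʲτ(X_τ) ⊆ τ(X_τ) with 0 < j < p, conjugating T
repeatedly through τ gives block codes of window [0, 1] whose pⁿ-th power is T^(jⁿ). There are
finitely many local rules, so two of these codes coincide, a nontrivial power of T is the identity,
and X_τ is finite. -/

namespace ConstLengthSubst

/-! ### Two-sided sequences -/

section Sequences

variable {A : Type*} {p : ℕ}

/-- The sequence `Tᵏ x`, for an integer `k`. -/
def shiftBy (k : ℤ) (x : ℤ → A) : ℤ → A := fun n => x (n + k)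

@[simp] theorem shiftBy_apply (k : ℤ) (x : ℤ → A) (n : ℤ) : shiftBy k x n = x (n + k) := rfl

@[simp] theorem shiftBy_zero (x : ℤ → A) : shiftBy 0 x = x := by
  funext n; simp

theorem shiftBy_shiftBy (k l : ℤ) (x : ℤ → A) :
    shiftBy k (shiftBy l x) = shiftBy (k + l) x := by
  funext n; simp [add_assoc]

theorem shiftBy_injective (k : ℤ) : Function.Injective (shiftBy k : (ℤ → A) → ℤ → A) := by
  intro x y h
  have := congrArg (shiftBy (-k)) h
  simpa [shiftBy_shiftBy] using this

variable [NeZero p] (τ : A → Fin p → A)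

theorem natCast_pos_of_neZero : (0 : ℤ) < p := by
  exact_mod_cast Nat.pos_of_ne_zero (NeZero.ne p)

theorem onSeq_apply (x : ℤ → A) (q : ℤ) (r : Fin p) :
    onSeq τ x ((p : ℤ) * q + (r : ℕ)) = τ (x q) r := by
  have hp := natCast_pos_of_neZero (p := p)
  have hr : ((r : ℕ) : ℤ) < p := by exact_mod_cast r.2
  have h0 : (0 : ℤ) ≤ ((r : ℕ) : ℤ) := by positivity
  have h1 : ((p : ℤ) * q + (r : ℕ)) / p = q := by
    rw [Int.mul_add_ediv_left _ _ hp.ne', Int.ediv_eq_zero_of_lt h0 hr, add_zero]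
  have h2 : ((p : ℤ) * q + (r : ℕ)) % p = (r : ℕ) := by
    rw [Int.mul_add_emod_self_left, Int.emod_eq_of_lt h0 hr]
  unfold onSeq
  congr 1
  · rw [h1]
  · apply Fin.ext
    simp [h2]

/-- Euclidean division of a coordinate by `p`. -/
theorem exists_eq_mul_add (n : ℤ) : ∃ (q : ℤ) (r : Fin p), n = (p : ℤ) * q + (r : ℕ) := by
  have hp := natCast_pos_of_neZero (p := p)
  have h1 := Int.emod_nonneg n hp.ne'
  have h2 := Int.emod_lt_of_pos n hp
  refine ⟨n / p, ⟨(n % p).toNat, by omega⟩, ?_⟩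
  have := Int.mul_ediv_add_emod n p
  simp only
  omega

theorem onSeq_shiftBy (x : ℤ → A) (q : ℤ) :
    onSeq τ (shiftBy q x) = shiftBy ((p : ℤ) * q) (onSeq τ x) := by
  funext n
  obtain ⟨m, r, rfl⟩ := exists_eq_mul_add (p := p) n
  rw [onSeq_apply, shiftBy_apply, shiftBy_apply,
    show (p : ℤ) * m + (r : ℕ) + p * q = p * (m + q) + (r : ℕ) by ring, onSeq_apply]

theorem iterate_onSeq_shiftBy (k : ℕ) (x : ℤ → A) (q : ℤ) :
    (onSeq τ)^[k] (shiftBy q x) = shiftBy ((p : ℤ) ^ k * q) ((onSeq τ)^[k] x) := by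
  induction k generalizing x q with
  | zero => simp
  | succ k ih =>
    rw [Function.iterate_succ_apply, onSeq_shiftBy, ih, ← Function.iterate_succ_apply]
    congr 1
    ring

variable {τ} in
theorem onSeq_injective (hτ : Function.Injective τ) : Function.Injective (onSeq τ) := by
  intro x y h
  funext q
  apply hτ
  funext r
  rw [← onSeq_apply τ x, ← onSeq_apply τ y, h]

/-- The coordinate `n` of `τᵏ(x)` lies in the word `τᵏ` of the letter of `x` at `n / pᵏ`. -/
theorem iterate_onSeq_eq_const (k : ℕ) (x : ℤ → A) (n : ℤ) :
    (onSeq τ)^[k] x n = (onSeq τ)^[k] (fun _ => x (n / (p : ℤ) ^ k)) n := by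
  induction k generalizing x with
  | zero => simp
  | succ k ih =>
    have hp := natCast_pos_of_neZero (p := p)
    have h : ∀ m, onSeq τ x (n / (p : ℤ) ^ k) = onSeq τ (fun _ => x m) (n / (p : ℤ) ^ k) ∨
        m ≠ n / (p : ℤ) ^ (k + 1) := by
      intro m
      by_cases hm : m = n / (p : ℤ) ^ (k + 1)
      · left
        rw [hm, pow_succ, ← Int.ediv_ediv_of_nonneg (by positivity)]
        rfl
      · exact Or.inr hm
    rw [Function.iterate_succ_apply, ih, Function.iterate_succ_apply, ih (onSeq τ _)]
    rw [(h (n / (p : ℤ) ^ (k + 1))).resolve_right (by simp)]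

theorem onSeq_congr {x y : ℤ → A} {n : ℤ} (h : ∀ j, 0 ≤ j → j < n → x j = y j) (j : ℤ)
    (h0 : 0 ≤ j) (hj : j < p * n) : onSeq τ x j = onSeq τ y j := by
  have hp := natCast_pos_of_neZero (p := p)
  unfold onSeq
  rw [h (j / p) (Int.ediv_nonneg h0 hp.le) (Int.ediv_lt_of_lt_mul hp (by linarith))]

end Sequences

/-! ### Words of the subshift -/

section Words

variable {A : Type*} {p : ℕ}

@[simp] theorem length_wordAt (x : ℤ → A) (i : ℤ) (n : ℕ) : (wordAt x i n).length = n := by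
  simp [wordAt]

theorem getElem_wordAt (x : ℤ → A) (i : ℤ) (n j : ℕ) (hj : j < (wordAt x i n).length) :
    (wordAt x i n)[j] = x (i + j) := by
  simp [wordAt]

theorem wordAt_eq_iff {x y : ℤ → A} {i j : ℤ} {n : ℕ} :
    wordAt x i n = wordAt y j n ↔ ∀ k : ℕ, k < n → x (i + k) = y (j + k) := by
  simp [wordAt]

theorem wordAt_add (x : ℤ → A) (i : ℤ) (m n : ℕ) :
    wordAt x i (m + n) = wordAt x i m ++ wordAt x (i + m) n := by
  unfold wordAt
  rw [List.range_add, List.map_append, List.map_map]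
  congr 1
  refine List.map_congr_left fun j _ => ?_
  simp [add_assoc]

theorem wordAt_infix_iff {w : List A} {y : ℤ → A} {L : ℕ} :
    w <:+: wordAt y 0 L ↔ ∃ m : ℕ, m + w.length ≤ L ∧ w = wordAt y m w.length := by
  constructor
  · rintro ⟨s, t, h⟩
    have hL : s.length + w.length + t.length = L := by
      have := congrArg List.length h
      simpa [add_assoc] using this
    refine ⟨s.length, by omega, ?_⟩
    rw [← hL, wordAt_add, wordAt_add] at h
    have h1 := List.append_inj_left h (by simp)
    have h2 := List.append_inj_right h1 (by simp)
    simpa using h2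
  · rintro ⟨m, hm, hw⟩
    refine ⟨wordAt y 0 m, wordAt y (m + w.length : ℕ) (L - (m + w.length)), ?_⟩
    obtain ⟨r, rfl⟩ := Nat.exists_eq_add_of_le hm
    conv_lhs => rw [hw]
    rw [wordAt_add, wordAt_add]
    simp

variable [NeZero p] (τ : A → Fin p → A)

theorem onWord_wordAt (x : ℤ → A) (i : ℤ) (n : ℕ) :
    onWord τ (wordAt x i n) = wordAt (onSeq τ x) (p * i) (p * n) := by
  induction n with
  | zero => simp [onWord, wordAt]
  | succ n ih =>
    rw [wordAt_add, mul_add, wordAt_add, mul_one]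
    have happ : ∀ v w : List A, onWord τ (v ++ w) = onWord τ v ++ onWord τ w := by
      intro v w
      simp [onWord]
    rw [happ, ih]
    congr 1
    have h : (p : ℤ) * i + (p * n : ℕ) = p * (i + n) := by push_cast; ring
    rw [h]
    apply List.ext_getElem
    · simp [onWord, wordAt]
    · intro j h1 h2
      have hj : j < p := by simpa using h2
      rw [getElem_wordAt, onSeq_apply τ x (i + n) ⟨j, hj⟩]
      simp [onWord, wordAt]

theorem iterate_onWord_wordAt (k : ℕ) (x : ℤ → A) (i : ℤ) (n : ℕ) :
    (onWord τ)^[k] (wordAt x i n) = wordAt ((onSeq τ)^[k] x) (p ^ k * i) (p ^ k * n) := by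
  induction k with
  | zero => simp
  | succ k ih =>
    rw [Function.iterate_succ_apply', ih, onWord_wordAt, Function.iterate_succ_apply']
    congr 1 <;> ring

theorem iterWord_eq (k : ℕ) (a : A) :
    iterWord τ k a = wordAt ((onSeq τ)^[k] fun _ => a) 0 (p ^ k) := by
  have := iterate_onWord_wordAt τ k (fun _ => a) 0 1
  simpa [wordAt, iterWord] using this

theorem mem_subshift_iff {x : ℤ → A} : x ∈ subshift τ ↔ ∀ (i : ℤ) (n : ℕ), ∃ (k : ℕ) (a : A) (m : ℕ),
    m + n ≤ p ^ k ∧ ∀ j : ℕ, j < n → x (i + j) = (onSeq τ)^[k] (fun _ => a) (m + j) := by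
  simp only [subshift, Set.mem_ofPred_eq, iterWord_eq, wordAt_infix_iff, length_wordAt,
    wordAt_eq_iff]

variable {τ} in
theorem isPrimitive_iff : IsPrimitive τ ↔
    ∃ n : ℕ, ∀ a b : A, ∃ m : ℕ, m < p ^ n ∧ (onSeq τ)^[n] (fun _ => b) m = a := by
  simp [IsPrimitive, iterWord_eq, wordAt]

variable {τ} in
theorem shiftBy_mem_subshift {x : ℤ → A} (hx : x ∈ subshift τ) (k : ℤ) :
    shiftBy k x ∈ subshift τ := by
  rw [mem_subshift_iff] at hx ⊢
  intro i n
  obtain ⟨l, a, m, h1, h2⟩ := hx (i + k) n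
  refine ⟨l, a, m, h1, fun j hj => ?_⟩
  rw [← h2 j hj, shiftBy_apply]
  congr 1
  ring

variable {τ} in
theorem onSeq_mem_subshift {x : ℤ → A} (hx : x ∈ subshift τ) : onSeq τ x ∈ subshift τ := by
  have hp := natCast_pos_of_neZero (p := p)
  rw [mem_subshift_iff] at hx ⊢
  intro i n
  obtain ⟨q, r, rfl⟩ := exists_eq_mul_add (p := p) i
  -- The window starts at place r < p of τ(x_q), so the images of n + 1 letters cover it.
  obtain ⟨k, a, m, h1, h2⟩ := hx q (n + 1)
  have hr := r.2
  have hp' : 0 < p := by exact_mod_cast hp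
  have hb : (r : ℕ) + n ≤ p * (n + 1) := by nlinarith
  refine ⟨k + 1, a, p * m + r, ?_, fun j hj => ?_⟩
  · calc p * m + r + n ≤ p * m + p * (n + 1) := by omega
      _ = p * (m + (n + 1)) := by ring
      _ ≤ p * p ^ k := Nat.mul_le_mul_left _ h1
      _ = p ^ (k + 1) := by ring
  · have key := onSeq_congr τ (x := shiftBy q x)
      (y := shiftBy m ((onSeq τ)^[k] fun _ => a)) (n := (n + 1 : ℕ)) (by
        intro j h0 hj
        lift j to ℕ using h0
        have := h2 j (by exact_mod_cast hj)
        simpa [add_comm] using this) ((r : ℕ) + j : ℕ) (by positivity)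
        (by
          have : (r : ℕ) + j < p * (n + 1) := by omega
          exact_mod_cast this)
    rw [onSeq_shiftBy, onSeq_shiftBy, ← Function.iterate_succ_apply' (onSeq τ)] at key
    simp only [shiftBy_apply] at key
    push_cast at key ⊢
    rw [show (p : ℤ) * q + (r : ℕ) + j = (r : ℕ) + j + p * q by ring, key]
    exact congrArg _ (by ring)

variable {τ} in
theorem iterate_onSeq_mem_subshift {x : ℤ → A} (hx : x ∈ subshift τ) (k : ℕ) :
    (onSeq τ)^[k] x ∈ subshift τ := by
  induction k with
  | zero => exact hx
  | succ k ih =>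
    rw [Function.iterate_succ_apply']
    exact onSeq_mem_subshift ih

variable {τ} in
theorem exists_mem_subshift_zero (hprim : IsPrimitive τ) {x : ℤ → A} (hx : x ∈ subshift τ)
    (a : A) : ∃ z ∈ subshift τ, z 0 = a := by
  obtain ⟨n, hn⟩ := isPrimitive_iff.1 hprim
  obtain ⟨m, hm, h⟩ := hn a (x 0)
  refine ⟨shiftBy m ((onSeq τ)^[n] x),
    shiftBy_mem_subshift (iterate_onSeq_mem_subshift hx n) _, ?_⟩
  rw [shiftBy_apply, iterate_onSeq_eq_const, zero_add,
    Int.ediv_eq_zero_of_lt (by positivity) (by exact_mod_cast hm), h]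

end Words

/-! ### Topology of the subshift and minimality -/

section Topology

variable {A : Type*} [TopologicalSpace A]

theorem continuous_shiftBy (k : ℤ) : Continuous (shiftBy k : (ℤ → A) → ℤ → A) :=
  continuous_pi fun n => continuous_apply (n + k)

variable [DiscreteTopology A]

theorem mem_closure_iff_agree {K : Set (ℤ → A)} {x : ℤ → A} :
    x ∈ closure K ↔ ∀ N : ℕ, ∃ y ∈ K, ∀ j : ℤ, |j| ≤ N → x j = y j := by
  constructor
  · intro hx N
    have ho : IsOpen ((Set.Icc (-N : ℤ) N).pi fun j => ({x j} : Set A)) :=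
      isOpen_set_pi (Set.finite_Icc _ _) fun _ _ => isOpen_discrete _
    obtain ⟨y, hy, hyK⟩ := mem_closure_iff.1 hx _ ho fun j _ => rfl
    exact ⟨y, hyK, fun j hj => (hy j (abs_le.1 hj)).symm⟩
  · intro h
    choose y hy hxy using h
    refine mem_closure_of_tendsto (f := y) (b := atTop) (tendsto_pi_nhds.2 fun j => ?_)
      (Eventually.of_forall hy)
    refine tendsto_const_nhds.congr' ?_
    filter_upwards [eventually_ge_atTop j.natAbs] with N hN
    exact hxy N j (by rw [Int.abs_eq_natAbs]; exact_mod_cast hN)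

theorem mem_of_isClosed_of_agree {K : Set (ℤ → A)} (hK : IsClosed K) {x : ℤ → A}
    (h : ∀ N : ℕ, ∃ y ∈ K, ∀ j : ℤ, |j| ≤ N → x j = y j) : x ∈ K :=
  hK.closure_eq ▸ mem_closure_iff_agree.2 h

/-- Two disjoint compact sets of sequences are told apart by a central window. -/
theorem exists_window_of_disjoint {K L : Set (ℤ → A)} (hK : IsCompact K) (hL : IsCompact L)
    (h : Disjoint K L) : ∃ N : ℕ, ∀ x ∈ K, ∀ y ∈ L, ∃ j : ℤ, |j| ≤ N ∧ x j ≠ y j := by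
  by_contra! hcon
  let C : ℕ → Set ((ℤ → A) × (ℤ → A)) := fun N =>
    (K ×ˢ L) ∩ ⋂ j ∈ {j : ℤ | |j| ≤ N}, {q | q.1 j = q.2 j}
  have hcl : ∀ N, IsClosed (⋂ j ∈ {j : ℤ | |j| ≤ N}, {q : (ℤ → A) × (ℤ → A) | q.1 j = q.2 j}) :=
    fun N => isClosed_biInter fun j _ => isClosed_eq
      ((continuous_apply j).comp continuous_fst) ((continuous_apply j).comp continuous_snd)
  have hco : ∀ N, IsCompact (C N) := fun N => (hK.prod hL).inter_right (hcl N)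
  obtain ⟨⟨x, y⟩, hq⟩ := IsCompact.nonempty_iInter_of_sequence_nonempty_isCompact_isClosed C
    (fun N => Set.inter_subset_inter_right _ (Set.biInter_subset_biInter_left fun j hj => by
      simp only [Set.mem_ofPred_eq] at hj ⊢; push_cast; omega))
    (fun N => by
      obtain ⟨x, hx, y, hy, h⟩ := hcon N
      exact ⟨(x, y), ⟨hx, hy⟩, by simpa using h⟩)
    (hco 0) (fun N => (hco N).isClosed)
  rw [Set.mem_iInter] at hq
  have hxy : x = y := by
    funext j
    have := (hq j.natAbs).2
    simp only [Set.mem_iInter] at this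
    exact this j (Int.abs_eq_natAbs j).le
  subst hxy
  exact Set.disjoint_left.1 h (hq 0).1.1 (hq 0).1.2

variable {p : ℕ} [NeZero p] (τ : A → Fin p → A)

theorem continuous_onSeq : Continuous (onSeq τ) := by
  refine continuous_pi fun n => ?_
  exact (continuous_of_discreteTopology (f := fun a => τ a ⟨(n % (p : ℤ)).toNat, _⟩)).comp
    (continuous_apply (n / (p : ℤ)))

theorem isClosed_subshift : IsClosed (subshift τ) := by
  refine isClosed_of_closure_subset fun x hx => ?_
  rw [mem_closure_iff_agree] at hx
  rw [mem_subshift_iff]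
  intro i n
  obtain ⟨y, hy, hxy⟩ := hx (i.natAbs + n)
  obtain ⟨k, a, m, h1, h2⟩ := (mem_subshift_iff τ).1 hy i n
  refine ⟨k, a, m, h1, fun j hj => ?_⟩
  rw [← h2 j hj]
  apply hxy
  have := Int.abs_eq_natAbs i
  have := neg_abs_le i
  have := le_abs_self i
  rw [abs_le]
  omega

theorem isCompact_subshift [Finite A] : IsCompact (subshift τ) :=
  (isClosed_subshift τ).isCompact

variable {τ}

/-- Every point of the subshift is a translate of the image of a point of the subshift. -/
theorem exists_desubst [Finite A] (hprim : IsPrimitive τ) {x : ℤ → A} (hx : x ∈ subshift τ) :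
    ∃ y ∈ subshift τ, ∃ r : Fin p, x = shiftBy (r : ℕ) (onSeq τ y) := by
  have hp := natCast_pos_of_neZero (p := p)
  have hcl : IsClosed (⋃ r : Fin p, (fun y => shiftBy (r : ℕ) (onSeq τ y)) '' subshift τ) :=
    isClosed_iUnion_of_finite fun r => ((isCompact_subshift τ).image
      ((continuous_shiftBy _).comp (continuous_onSeq τ))).isClosed
  have hmem := mem_of_isClosed_of_agree (x := x) hcl fun N => ?_
  · simp only [Set.mem_iUnion, Set.mem_image] at hmem
    obtain ⟨r, y, hy, h⟩ := hmem
    exact ⟨y, hy, r, h.symm⟩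
  -- The window is one wider on each side than needed: its length exceeds 1 = p⁰, which excludes k =
  -- 0, so one τ can be split off.
  · obtain ⟨k, a, m, h1, h2⟩ := (mem_subshift_iff τ).1 hx (-(N + 1 : ℕ)) (2 * (N + 1) + 1)
    obtain ⟨z, hz, rfl⟩ := exists_mem_subshift_zero hprim hx a
    obtain _ | k := k
    · simp at h1
      omega
    obtain ⟨q, r, hqr⟩ := exists_eq_mul_add (p := p) (m + (N + 1 : ℕ))
    refine ⟨shiftBy (r : ℕ) (onSeq τ (shiftBy q ((onSeq τ)^[k] z))), ?_, fun j hj => ?_⟩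
    · rw [Set.mem_iUnion]
      exact ⟨r, _, shiftBy_mem_subshift (iterate_onSeq_mem_subshift hz k) q, rfl⟩
    · rw [onSeq_shiftBy, shiftBy_shiftBy, ← Function.iterate_succ_apply' (onSeq τ),
        shiftBy_apply]
      rw [abs_le] at hj
      obtain ⟨l, hl⟩ : ∃ l : ℕ, j = -(N + 1 : ℕ) + l := ⟨(j + (N + 1)).toNat, by omega⟩
      have hl' : l < 2 * (N + 1) + 1 := by omega
      have h3 := h2 l hl'
      rw [← hl] at h3
      rw [h3, show j + ((r : ℕ) + (p : ℤ) * q) = m + l by omega, iterate_onSeq_eq_const _ _ z,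
        Int.ediv_eq_zero_of_lt (by positivity)]
      have : m + l < p ^ (k + 1) := by omega
      exact_mod_cast this

theorem exists_iterate_desubst [Finite A] (hprim : IsPrimitive τ) (k : ℕ) {x : ℤ → A}
    (hx : x ∈ subshift τ) :
    ∃ y ∈ subshift τ, ∃ m : ℤ, x = shiftBy m ((onSeq τ)^[k] y) := by
  induction k with
  | zero => exact ⟨x, hx, 0, by simp⟩
  | succ k ih =>
    obtain ⟨y, hy, m, rfl⟩ := ih
    obtain ⟨z, hz, r, rfl⟩ := exists_desubst hprim hy
    refine ⟨z, hz, m + p ^ k * (r : ℕ), ?_⟩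
    rw [iterate_onSeq_shiftBy, shiftBy_shiftBy, Function.iterate_succ_apply]

/-- Minimality of the subshift. -/
theorem subshift_subset_of_orbit_subset [Finite A] (hprim : IsPrimitive τ) {y : ℤ → A}
    (hy : y ∈ subshift τ) {K : Set (ℤ → A)} (hK : IsClosed K)
    (h : ∀ n : ℤ, shiftBy n y ∈ K) : subshift τ ⊆ K := by
  intro x hx
  have hp := natCast_pos_of_neZero (p := p)
  refine mem_of_isClosed_of_agree hK fun N => ?_
  obtain ⟨k, a, m, h1, h2⟩ := (mem_subshift_iff τ).1 hx (-N) (2 * N + 1)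
  obtain ⟨l, hl⟩ := isPrimitive_iff.1 hprim
  obtain ⟨z, hz, e, rfl⟩ := exists_iterate_desubst hprim (k + l) hy
  obtain ⟨i, hi, hi'⟩ := hl a (z 0)
  -- The window of x starts at place m of τᵏ(a), and a is the letter at place i of τˡ(z₀), so the
  -- window occurs in τᵏ⁺ˡ(z) from place m + pᵏi on.
  refine ⟨_, h ((m + N + p ^ k * i : ℤ) - e), fun j hj => ?_⟩
  rw [abs_le] at hj
  obtain ⟨t, ht⟩ : ∃ t : ℕ, j = -N + t := ⟨(j + N).toNat, by omega⟩
  have h3 := h2 t (by omega)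
  rw [← ht] at h3
  rw [h3, shiftBy_shiftBy, shiftBy_apply, Function.iterate_add_apply,
    iterate_onSeq_eq_const _ _ ((onSeq τ)^[l] z)]
  have hlt : (m + t : ℤ) < (p : ℤ) ^ k := by
    have : m + t < p ^ k := by omega
    exact_mod_cast this
  have e1 : j + ((m : ℤ) + N + p ^ k * i - e + e) = (m + t) + p ^ k * i := by rw [ht]; ring
  rw [e1, Int.add_mul_ediv_left _ _ (by positivity), Int.ediv_eq_zero_of_lt (by positivity) hlt,
    zero_add, iterate_onSeq_eq_const _ l z, Int.ediv_eq_zero_of_lt (by positivity)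
      (by exact_mod_cast hi), hi']
  have e2 := congrFun (iterate_onSeq_shiftBy τ k (fun _ : ℤ => a) i) (m + t)
  rw [shiftBy_apply] at e2
  rw [← e2]
  rfl

end Topology

/-! ### Recognizability -/

section SlidingBlock

variable {A : Type*}

/-- The sliding block code with window `[0, 1]` and local rule `f`. -/
def blockCode (f : A → A → A) (x : ℤ → A) : ℤ → A := fun n => f (x n) (x (n + 1))

theorem blockCode_shiftBy (f : A → A → A) (k : ℤ) (x : ℤ → A) :
    blockCode f (shiftBy k x) = shiftBy k (blockCode f x) := by
  funext n
  simp [blockCode, add_right_comm]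

theorem iterate_blockCode_shiftBy (f : A → A → A) (i : ℕ) (k : ℤ) (x : ℤ → A) :
    (blockCode f)^[i] (shiftBy k x) = shiftBy k ((blockCode f)^[i] x) := by
  have h : Function.Commute (blockCode f) (shiftBy k) := fun x => blockCode_shiftBy f k x
  exact h.iterate_left i x

theorem iterate_blockCode_congr (f : A → A → A) (i : ℕ) {x y : ℤ → A} {n : ℤ}
    (h : ∀ j, n ≤ j → j ≤ n + i → x j = y j) :
    (blockCode f)^[i] x n = (blockCode f)^[i] y n := by
  induction i generalizing n with
  | zero => exact h n le_rfl (by simp)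
  | succ i ih =>
    rw [Function.iterate_succ_apply', Function.iterate_succ_apply']
    change f _ _ = f _ _
    rw [ih fun j h1 h2 => h j h1 (by push_cast; omega),
      ih fun j h1 h2 => h j (by omega) (by push_cast; omega)]

theorem continuous_blockCode [TopologicalSpace A] [DiscreteTopology A] (f : A → A → A) :
    Continuous (blockCode f) := by
  refine continuous_pi fun n => ?_
  have h : Continuous fun x : ℤ → A => (x n, x (n + 1)) :=
    (continuous_apply n).prodMk (continuous_apply (n + 1))
  exact (continuous_of_discreteTopology (f := fun q : A × A => f q.1 q.2)).comp h

theorem finite_of_shiftBy_eq_self [Finite A] {X : Set (ℤ → A)} {e : ℤ} (he : 0 < e)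
    (h : ∀ x ∈ X, shiftBy e x = x) : X.Finite := by
  have hmul : ∀ x ∈ X, ∀ n : ℤ, x n = x (n % e) := by
    intro x hx n
    have hper : Function.Periodic x e := fun n => congrFun (h x hx) n
    conv_lhs => rw [← Int.emod_add_mul_ediv n e, mul_comm]
    exact hper.int_mul (n / e) (n % e)
  refine Set.Finite.of_finite_image (f := fun x => fun i : Fin e.toNat => x (i : ℕ))
    (Set.toFinite _) fun x hx y hy hxy => ?_
  funext n
  rw [hmul x hx, hmul y hy]
  have h1 := Int.emod_nonneg n he.ne'
  have h2 := Int.emod_lt_of_pos n he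
  have := congrFun hxy ⟨(n % e).toNat, by omega⟩
  simpa [Int.toNat_of_nonneg h1] using this

end SlidingBlock

/-! ### Recognizability through roots of powers of the shift -/

section Recognizability

variable {A : Type*} {p : ℕ} [NeZero p] {τ : A → Fin p → A}

theorem iterate_eq_shiftBy_mul {R : (ℤ → A) → ℤ → A} {m : ℕ} {k : ℕ}
    (h : ∀ x ∈ subshift τ, R^[m] x = shiftBy k x) (i : ℕ) {x : ℤ → A} (hx : x ∈ subshift τ) :
    R^[m * i] x = shiftBy (k * i : ℕ) x := by
  induction i with
  | zero => simp
  | succ i ih =>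
    rw [Nat.mul_succ, add_comm, Function.iterate_add_apply, ih,
      h _ (shiftBy_mem_subshift hx _), shiftBy_shiftBy]
    congr 1
    push_cast
    ring

variable [TopologicalSpace A] [DiscreteTopology A] [Finite A]

theorem isClosed_image_shiftBy_onSeq (e : ℤ) :
    IsClosed ((fun x => shiftBy e (onSeq τ x)) '' subshift τ) :=
  ((isCompact_subshift τ).image
    ((continuous_shiftBy _).comp (continuous_onSeq τ))).isClosed

/-- If a sliding block code preserves `X_τ`, then it maps `τ(X_τ)` into a translate of `τ(X_τ)`. -/
theorem exists_blockCode_onSeq_eq (hprim : IsPrimitive τ) (hne : (subshift τ).Nonempty)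
    {f : A → A → A} (hf : ∀ x ∈ subshift τ, blockCode f x ∈ subshift τ) :
    ∃ r : ℕ, ∀ u ∈ subshift τ, ∃ v ∈ subshift τ,
      blockCode f (onSeq τ u) = shiftBy r (onSeq τ v) := by
  obtain ⟨x, hx⟩ := hne
  obtain ⟨y, hy, r, h⟩ := exists_desubst hprim (hf _ (onSeq_mem_subshift hx))
  refine ⟨r, fun u hu => ?_⟩
  -- The condition on u is closed and holds along the orbit of x, so minimality extends it to X_τ.
  have := subshift_subset_of_orbit_subset hprim hx
    (K := (fun u => blockCode f (onSeq τ u)) ⁻¹'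
      ((fun x => shiftBy (r : ℕ) (onSeq τ x)) '' subshift τ))
    ((isClosed_image_shiftBy_onSeq _).preimage
      ((continuous_blockCode f).comp (continuous_onSeq τ))) (fun n => by
        refine ⟨shiftBy n y, shiftBy_mem_subshift hy n, ?_⟩
        simp only
        rw [onSeq_shiftBy, onSeq_shiftBy, blockCode_shiftBy, h, shiftBy_shiftBy,
          shiftBy_shiftBy, add_comm]) hu
  obtain ⟨v, hv, h'⟩ := this
  exact ⟨v, hv, h'.symm⟩

/-- Minimality spreads a single failure of recognizability to all of X_τ. -/
theorem exists_shiftBy_onSeq_eq (hprim : IsPrimitive τ) {y z : ℤ → A} (hy : y ∈ subshift τ)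
    (hz : z ∈ subshift τ) {e : ℤ} (h : shiftBy e (onSeq τ y) = onSeq τ z) :
    ∀ u ∈ subshift τ, ∃ v ∈ subshift τ, shiftBy e (onSeq τ u) = onSeq τ v := by
  intro u hu
  have := subshift_subset_of_orbit_subset hprim hy
    (K := (fun u => shiftBy e (onSeq τ u)) ⁻¹' ((fun x => shiftBy 0 (onSeq τ x)) '' subshift τ))
    ((isClosed_image_shiftBy_onSeq _).preimage
      ((continuous_shiftBy e).comp (continuous_onSeq τ))) (fun n => by
        refine ⟨shiftBy n z, shiftBy_mem_subshift hz n, ?_⟩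
        simp only
        rw [shiftBy_zero, onSeq_shiftBy, onSeq_shiftBy, ← h, shiftBy_shiftBy,
          shiftBy_shiftBy, add_comm]) hu
  obtain ⟨v, hv, h'⟩ := this
  exact ⟨v, hv, by simpa using h'.symm⟩

/-- If `Tʲ τ(X_τ) ⊆ τ(X_τ)` with `j < p`, a block code `R` of `X_τ` gives the block code
`τ⁻¹ Rʲ τ`, which has the same window `[0, 1]`. -/
theorem exists_blockCode_conj (hτ : Function.Injective τ) (hprim : IsPrimitive τ)
    (hne : (subshift τ).Nonempty) {j : ℕ} (hj : j < p)
    (H : ∀ u ∈ subshift τ, ∃ v ∈ subshift τ, shiftBy j (onSeq τ u) = onSeq τ v)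
    {f : A → A → A} (hf : ∀ x ∈ subshift τ, blockCode f x ∈ subshift τ) :
    ∃ g : A → A → A, (∀ x ∈ subshift τ, blockCode g x ∈ subshift τ) ∧
      ∀ x ∈ subshift τ, onSeq τ (blockCode g x) = (blockCode f)^[j] (onSeq τ x) := by
  classical
  obtain ⟨r, hr⟩ := exists_blockCode_onSeq_eq hprim hne hf
  have hiter : ∀ i : ℕ, ∀ u ∈ subshift τ, ∃ v ∈ subshift τ,
      (blockCode f)^[i] (onSeq τ u) = shiftBy (i * r : ℕ) (onSeq τ v) := by
    intro i u hu
    induction i with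
    | zero => exact ⟨u, hu, by simp⟩
    | succ i ih =>
      obtain ⟨v, hv, h⟩ := ih
      obtain ⟨w, hw, h'⟩ := hr v hv
      refine ⟨w, hw, ?_⟩
      rw [Function.iterate_succ_apply', h, blockCode_shiftBy, h', shiftBy_shiftBy]
      congr 1
      push_cast
      ring
  -- The j-th power of the code lands in T^(jr) τ(X_τ), and applying `H` r times brings this back
  -- into τ(X_τ). This is why the power j is taken.
  have hmul : ∀ r : ℕ, ∀ u ∈ subshift τ, ∃ v ∈ subshift τ,
      shiftBy (j * r : ℕ) (onSeq τ u) = onSeq τ v := by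
    intro r u hu
    induction r with
    | zero => exact ⟨u, hu, by simp⟩
    | succ r ih =>
      obtain ⟨v, hv, h⟩ := ih
      obtain ⟨w, hw, h'⟩ := H v hv
      refine ⟨w, hw, ?_⟩
      rw [← h', ← h, shiftBy_shiftBy]
      congr 1
      push_cast
      ring
  have hex : ∀ u : subshift τ, ∃ v ∈ subshift τ, (blockCode f)^[j] (onSeq τ u.1) = onSeq τ v := by
    intro u
    obtain ⟨v, hv, h⟩ := hiter j u.1 u.2
    obtain ⟨w, hw, h'⟩ := hmul r v hv
    exact ⟨w, hw, h.trans h'⟩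
  choose G hG hGeq using hex
  -- The word τ((G u)₀) depends on the coordinates 0, …, p - 1 + j of τ(u). As j < p, these lie in
  -- τ(u₀)τ(u₁), so the window does not grow.
  have hloc : ∀ u v : subshift τ, u.1 0 = v.1 0 → u.1 1 = v.1 1 → G u 0 = G v 0 := by
    intro u v h0 h1
    apply hτ
    funext s
    rw [← onSeq_apply τ (G u), ← onSeq_apply τ (G v), ← hGeq, ← hGeq]
    apply iterate_blockCode_congr
    intro i hi hi'
    have hs := s.2
    refine onSeq_congr τ (n := 2) (fun l hl hl' => ?_) i (by omega) (by omega)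
    obtain rfl | rfl : l = 0 ∨ l = 1 := by omega
    · exact h0
    · exact h1
  have hequi : ∀ (u : subshift τ) (q : ℤ) (h : shiftBy q u.1 ∈ subshift τ),
      G ⟨shiftBy q u.1, h⟩ = shiftBy q (G u) := by
    intro u q h
    apply onSeq_injective hτ
    rw [← hGeq, onSeq_shiftBy, onSeq_shiftBy, iterate_blockCode_shiftBy, hGeq]
  obtain ⟨x₀, hx₀⟩ := hne
  -- The value on pairs of letters that do not occur in X_τ is arbitrary.
  let g : A → A → A := fun a b =>
    if h : ∃ u : subshift τ, u.1 0 = a ∧ u.1 1 = b then G h.choose 0 else a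
  have hg : ∀ u : subshift τ, blockCode g u.1 = G u := by
    intro u
    funext q
    have hmem := shiftBy_mem_subshift u.2 q
    have h : ∃ v : subshift τ, v.1 0 = u.1 q ∧ v.1 1 = u.1 (q + 1) :=
      ⟨⟨shiftBy q u.1, hmem⟩, by simp, by simp [add_comm]⟩
    have hs := h.choose_spec
    have : g (u.1 q) (u.1 (q + 1)) = G h.choose 0 := dif_pos h
    rw [blockCode, this, hloc h.choose ⟨shiftBy q u.1, hmem⟩ (by simpa using hs.1)
      (by simpa [add_comm] using hs.2), hequi]
    simp
  refine ⟨g, fun x hx => ?_, fun x hx => ?_⟩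
  · rw [hg ⟨x, hx⟩]
    exact hG _
  · rw [hg ⟨x, hx⟩, ← hGeq]

/-- If `Tʲ τ(X_τ) ⊆ τ(X_τ)` with `j < p`, there are block codes `R` of window `[0, 1]` on `X_τ`
with `R ^ (pⁿ) = T ^ (jⁿ)`. -/
theorem exists_blockCode_root (hτ : Function.Injective τ) (hprim : IsPrimitive τ)
    (hne : (subshift τ).Nonempty) {j : ℕ} (hj : j < p)
    (H : ∀ u ∈ subshift τ, ∃ v ∈ subshift τ, shiftBy j (onSeq τ u) = onSeq τ v) (n : ℕ) :
    ∃ f : A → A → A, (∀ x ∈ subshift τ, blockCode f x ∈ subshift τ) ∧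
      ∀ x ∈ subshift τ, (blockCode f)^[p ^ n] x = shiftBy (j ^ n : ℕ) x := by
  induction n with
  | zero =>
    have h : ∀ x : ℤ → A, blockCode (fun _ b => b) x = shiftBy 1 x := fun x => rfl
    refine ⟨fun _ b => b, fun x hx => ?_, fun x _ => ?_⟩
    · rw [h]
      exact shiftBy_mem_subshift hx 1
    · simp [h]
  | succ n ih =>
    obtain ⟨f, hf, hroot⟩ := ih
    obtain ⟨g, hg, hgf⟩ := exists_blockCode_conj hτ hprim hne hj H hf
    refine ⟨g, hg, fun x hx => ?_⟩
    have hgi : ∀ i, (blockCode g)^[i] x ∈ subshift τ ∧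
        onSeq τ ((blockCode g)^[i] x) = (blockCode f)^[j * i] (onSeq τ x) := by
      intro i
      induction i with
      | zero => exact ⟨hx, rfl⟩
      | succ i ih =>
        rw [Function.iterate_succ_apply', hgf _ ih.1, ih.2, ← Function.iterate_add_apply,
          Nat.mul_succ, add_comm]
        exact ⟨hg _ ih.1, rfl⟩
    -- After applying τ, the power pⁿ⁺¹ of the new code becomes the power pⁿ·(jp) of the old one,
    -- which is T^(p·jⁿ⁺¹) on τ(X_τ), and T^(pq) τ = τ T^q.
    apply onSeq_injective hτ
    rw [(hgi _).2, show j * p ^ (n + 1) = p ^ n * (j * p) by ring,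
      iterate_eq_shiftBy_mul hroot _ (onSeq_mem_subshift hx), onSeq_shiftBy]
    congr 1
    push_cast
    ring

/-- Two of the roots, for exponents n < m, have the same local rule. Its pᵐ-th power is both T^(jᵐ)
and T^(jⁿ pᵐ⁻ⁿ), and jᵐ < jⁿ pᵐ⁻ⁿ, so all points share a positive period. -/
theorem not_shiftBy_onSeq_subset (hτ : Function.Injective τ) (hprim : IsPrimitive τ)
    (hinf : (subshift τ).Infinite) {j : ℕ} (hj0 : 0 < j) (hj : j < p) :
    ¬ ∀ u ∈ subshift τ, ∃ v ∈ subshift τ, shiftBy j (onSeq τ u) = onSeq τ v := by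
  intro H
  choose f hf hroot using exists_blockCode_root hτ hprim hinf.nonempty hj H
  obtain ⟨n, m, hnm, hfe⟩ : ∃ n m, n < m ∧ f n = f m := by
    obtain ⟨n, m, hne, hfe⟩ := Finite.exists_ne_map_eq_of_infinite f
    rcases lt_or_gt_of_ne hne with h | h
    · exact ⟨n, m, h, hfe⟩
    · exact ⟨m, n, h, hfe.symm⟩
  obtain ⟨d, rfl⟩ := Nat.exists_eq_add_of_lt hnm
  have hlt : j ^ (n + d + 1) < j ^ n * p ^ (d + 1) := by
    rw [add_assoc, pow_add]
    exact Nat.mul_lt_mul_of_pos_left (Nat.pow_lt_pow_left hj (by simp)) (by positivity)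
  refine hinf (finite_of_shiftBy_eq_self
    (e := (j ^ n * p ^ (d + 1) : ℕ) - (j ^ (n + d + 1) : ℕ)) (by omega) fun x hx => ?_)
  have h1 := hroot (n + d + 1) x hx
  have h2 := iterate_eq_shiftBy_mul (hroot n) (p ^ (d + 1)) hx
  rw [← pow_add, ← add_assoc, hfe, h1] at h2
  have h3 := congrArg (shiftBy (-(j ^ (n + d + 1) : ℕ) : ℤ)) h2
  rw [shiftBy_shiftBy, shiftBy_shiftBy, neg_add_cancel, shiftBy_zero] at h3
  rw [sub_eq_neg_add, ← h3]

/-- Recognizability: the point `y` and the digit `r` with `x = Tʳ τ(y)` are unique. -/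
theorem eq_of_onSeq_eq_shiftBy (hτ : Function.Injective τ) (hprim : IsPrimitive τ)
    (hinf : (subshift τ).Infinite) {u v : ℤ → A} (hu : u ∈ subshift τ) (hv : v ∈ subshift τ)
    {e : ℤ} (h1 : -p < e) (h2 : e < p) (h : shiftBy e (onSeq τ u) = onSeq τ v) :
    e = 0 ∧ u = v := by
  have he : e = 0 := by
    rcases lt_trichotomy e 0 with h0 | h0 | h0
    · exfalso
      obtain ⟨j, rfl⟩ := Int.exists_eq_neg_ofNat h0.le
      refine not_shiftBy_onSeq_subset hτ hprim hinf (j := j) (by omega) (by omega)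
        (exists_shiftBy_onSeq_eq hprim hv hu ?_)
      rw [← h, shiftBy_shiftBy]
      simp
    · exact h0
    · exfalso
      lift e to ℕ using h0.le
      exact not_shiftBy_onSeq_subset hτ hprim hinf (j := e) (by omega) (by omega)
        (exists_shiftBy_onSeq_eq hprim hu hv h)
  subst he
  exact ⟨rfl, onSeq_injective hτ (by simpa using h)⟩

/-- Uniform recognizability: for `0 < |e| < p`, a bounded window tells `Tᵉ τ(u)` from `τ(v)`. -/
theorem exists_window_shiftBy_onSeq_ne (hτ : Function.Injective τ) (hprim : IsPrimitive τ)
    (hinf : (subshift τ).Infinite) {e : ℤ} (h1 : -p < e) (h2 : e < p) (he : e ≠ 0) :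
    ∃ N : ℕ, ∀ u ∈ subshift τ, ∀ v ∈ subshift τ,
      ∃ j : ℤ, |j| ≤ N ∧ shiftBy e (onSeq τ u) j ≠ onSeq τ v j := by
  have hco : ∀ e : ℤ, IsCompact ((fun x => shiftBy e (onSeq τ x)) '' subshift τ) := fun e =>
    (isCompact_subshift τ).image ((continuous_shiftBy _).comp (continuous_onSeq τ))
  obtain ⟨N, hN⟩ := exists_window_of_disjoint (hco e) (hco 0) (by
    rw [Set.disjoint_left]
    rintro _ ⟨u, hu, rfl⟩ ⟨v, hv, h⟩
    simp only [shiftBy_zero] at h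
    exact he (eq_of_onSeq_eq_shiftBy hτ hprim hinf hu hv h1 h2 h.symm).1)
  refine ⟨N, fun u hu v hv => ?_⟩
  simpa using hN _ ⟨u, hu, rfl⟩ _ ⟨v, hv, rfl⟩

end Recognizability

/-! ### Digit sequences -/

section Digits

variable {p : ℕ}

/-- The carries in the addition of `k` to the `p`-adic integer with the digits `δ`. -/
def carry (δ : ℕ → Fin p) (k : ℕ) : ℕ → ℕ
  | 0 => k
  | i + 1 => (carry δ k i + δ i) / p

theorem carry_succ_eq (δ : ℕ → Fin p) (k i : ℕ) :
    carry δ k (i + 1) = carry (fun j => δ (j + 1)) ((k + δ 0) / p) i := by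
  induction i with
  | zero => rfl
  | succ i ih => rw [carry, ih, carry]

/-- The number `∑_{j < i} δ_j pʲ`. -/
def offset (δ : ℕ → Fin p) (i : ℕ) : ℕ := ∑ j ∈ Finset.range i, (δ j : ℕ) * p ^ j

/-- The length `pⁱ - ∑_{j < i} δ_j pʲ` of the part of a block of level `i` that lies on the
right of the position with the digits `δ`. -/
def reach (δ : ℕ → Fin p) (i : ℕ) : ℕ := 1 + ∑ j ∈ Finset.range i, (p - 1 - (δ j : ℕ)) * p ^ j

theorem reach_succ (δ : ℕ → Fin p) (i : ℕ) :
    reach δ (i + 1) = reach δ i + (p - 1 - (δ i : ℕ)) * p ^ i := by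
  rw [reach, Finset.sum_range_succ, ← add_assoc, reach]

theorem offset_succ (δ : ℕ → Fin p) (i : ℕ) :
    offset δ (i + 1) = offset δ i + (δ i : ℕ) * p ^ i := by
  rw [offset, Finset.sum_range_succ, offset]

/-- The block of level i has length pⁱ. `offset` counts its coordinates before the origin and
`reach` the rest, the origin included. -/
theorem reach_add_offset (δ : ℕ → Fin p) (i : ℕ) : reach δ i + offset δ i = p ^ i := by
  induction i with
  | zero => simp [reach, offset]
  | succ i ih =>
    have h := (δ i).2
    obtain ⟨c, hc⟩ : ∃ c, p = δ i + 1 + c := Nat.exists_eq_add_of_le h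
    have h2 : p - 1 - (δ i : ℕ) = c := by omega
    rw [reach_succ, offset_succ, pow_succ, h2]
    calc _ = (reach δ i + offset δ i) + (c + δ i) * p ^ i := by ring
      _ = p ^ i * (δ i + 1 + c) := by rw [ih]; ring
      _ = p ^ i * p := by rw [← hc]

theorem reach_mono (δ : ℕ → Fin p) : Monotone (reach δ) :=
  monotone_nat_of_le_succ fun i => by rw [reach_succ]; omega

theorem reach_pos (δ : ℕ → Fin p) (i : ℕ) : 0 < reach δ i := by
  unfold reach; omega

/-- Each digit other than p - 1 lengthens the reach. Through this lemma the infinitude of I⁺ enters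
the arguments on half-lines. -/
theorem tendsto_reach {δ : ℕ → Fin p} (h : {i | (δ i : ℕ) ≠ p - 1}.Infinite) :
    Tendsto (reach δ) atTop atTop := by
  refine tendsto_atTop_atTop_of_monotone (reach_mono δ) fun b => ?_
  induction b with
  | zero => exact ⟨0, by omega⟩
  | succ b ih =>
    obtain ⟨i, hi⟩ := ih
    obtain ⟨j, hj, hij⟩ := h.exists_gt i
    refine ⟨j + 1, ?_⟩
    rw [reach_succ]
    have h1 := reach_mono δ hij.le
    have h2 : 0 < (p - 1 - (δ j : ℕ)) * p ^ j := by
      have := (δ j).2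
      have hj' : (δ j : ℕ) ≠ p - 1 := hj
      exact Nat.mul_pos (by omega) (Nat.pow_pos (by omega))
    omega

theorem exists_lt_reach {δ : ℕ → Fin p} (hδ : {i | (δ i : ℕ) ≠ p - 1}.Infinite) (n : ℕ) : ∃ i, n < reach δ i :=
  ((tendsto_reach hδ).eventually_gt_atTop n).exists

/-- Adding `reach δ M` clears the digits below `M`. -/
theorem dvd_carry_reach (δ : ℕ → Fin p) {M j : ℕ} (hj : j < M) :
    p ∣ carry δ (reach δ M) j + δ j := by
  induction M generalizing δ j with
  | zero => omega
  | succ M ih =>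
    have h0 := (δ 0).2
    -- The leading 1 and the lowest term p - 1 - δ₀ add up with δ₀ to p, so the lowest digit is
    -- cleared with carry `reach` of the remaining digits.
    have hM : reach δ (M + 1) + δ 0 = p * reach (fun j => δ (j + 1)) M := by
      rw [reach, Finset.sum_range_succ', reach, mul_add, Finset.mul_sum]
      have : ∑ k ∈ Finset.range M, (p - 1 - (δ (k + 1) : ℕ)) * p ^ (k + 1)
          = ∑ i ∈ Finset.range M, p * ((p - 1 - (δ (i + 1) : ℕ)) * p ^ i) :=
        Finset.sum_congr rfl fun i _ => by ring
      rw [this, pow_zero, mul_one]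
      omega
    cases j with
    | zero =>
      rw [carry, hM]
      exact dvd_mul_right _ _
    | succ j =>
      rw [carry_succ_eq, hM, Nat.mul_div_cancel_left _ (by omega)]
      exact ih (fun j => δ (j + 1)) (by omega)

variable [NeZero p]

/-- The digits of the sum of `k` and the `p`-adic integer with the digits `δ`. -/
def addDigits (δ : ℕ → Fin p) (k : ℕ) : ℕ → Fin p := fun i => Fin.ofNat p (carry δ k i + δ i)

theorem addDigits_reach (δ : ℕ → Fin p) {M j : ℕ} (hj : j < M) :
    (addDigits δ (reach δ M) j : ℕ) = 0 := by
  have := dvd_carry_reach δ hj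
  simpa [addDigits] using Nat.mod_eq_zero_of_dvd this

end Digits

/-! ### Desubstitution -/

section Desubstitution

variable {A : Type*} {p : ℕ} {τ : A → Fin p → A}

theorem shift_iterate_val (k : ℕ) (x : subshift τ) : ((shift τ)^[k] x).1 = shiftBy k x.1 := by
  induction k with
  | zero => simp
  | succ k ih =>
    rw [Function.iterate_succ_apply']
    change (fun n : ℤ => ((shift τ)^[k] x).1 (n + 1)) = _
    rw [ih]
    funext n
    simp only [shiftBy_apply]
    exact congrArg _ (by push_cast; ring)

theorem length_iterate_onWord (k : ℕ) (w : List A) :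
    ((onWord τ)^[k] w).length = p ^ k * w.length := by
  induction k with
  | zero => simp
  | succ k ih =>
    rw [Function.iterate_succ_apply', pow_succ, mul_comm (p ^ k), mul_assoc, ← ih]
    simp [onWord, mul_comm]

variable [NeZero p]

theorem isDesubstitution_iff {x : ℤ → A} {xs : ℕ → ℤ → A} {δ : ℕ → Fin p} :
    IsDesubstitution τ x xs δ ↔ xs 0 = x ∧ (∀ i, xs i ∈ subshift τ) ∧
      ∀ i, xs i = shiftBy (δ i : ℕ) (onSeq τ (xs (i + 1))) := by
  refine and_congr_right fun _ => and_congr_right fun _ => forall_congr' fun i => ?_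
  constructor
  · intro h
    rw [h]
    funext n
    simp
  · intro h
    funext n
    rw [h]
    simp

/-- The shift acts as addition on the odometer: a total shift c + δ_i = p c' + δ' of τ(x⁽ⁱ⁺¹⁾)
splits into the digit δ' and a shift by c' one level up. -/
theorem IsDesubstitution.shiftBy_addDigits {x : ℤ → A} {xs : ℕ → ℤ → A} {δ : ℕ → Fin p}
    (h : IsDesubstitution τ x xs δ) (k : ℕ) :
    IsDesubstitution τ (shiftBy k x) (fun i => shiftBy (carry δ k i) (xs i))
      (addDigits δ k) := by
  rw [isDesubstitution_iff] at h ⊢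
  obtain ⟨h0, h1, h2⟩ := h
  refine ⟨by rw [carry, h0], fun i => shiftBy_mem_subshift (h1 i) _, fun i => ?_⟩
  rw [onSeq_shiftBy, shiftBy_shiftBy, h2 i, shiftBy_shiftBy]
  congr 1
  have := Nat.mod_add_div (carry δ k i + δ i) p
  simp only [carry, addDigits, Fin.val_ofNat]
  exact_mod_cast this.symm

theorem IsDesubstitution.apply_eq {x : ℤ → A} {xs : ℕ → ℤ → A} {δ : ℕ → Fin p}
    (h : IsDesubstitution τ x xs δ) (i : ℕ) (n : ℤ) :
    x n = (onSeq τ)^[i] (xs i) (n + offset δ i) := by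
  rw [isDesubstitution_iff] at h
  obtain ⟨h0, -, h2⟩ := h
  induction i generalizing n with
  | zero => simp [offset, h0]
  | succ i ih =>
    rw [ih, h2 i, iterate_onSeq_shiftBy, shiftBy_apply, ← Function.iterate_succ_apply (onSeq τ),
      offset_succ]
    exact congrArg _ (by push_cast; ring)

/-! ### Existence and uniqueness of the desubstitution -/

section Unique

variable [TopologicalSpace A] [DiscreteTopology A] [Finite A]

theorem IsDesubstitution.unique (hτ : Function.Injective τ) (hprim : IsPrimitive τ)
    (hinf : (subshift τ).Infinite) {x : ℤ → A} {xs ys : ℕ → ℤ → A} {δ ε : ℕ → Fin p}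
    (hx : IsDesubstitution τ x xs δ) (hy : IsDesubstitution τ x ys ε) : xs = ys ∧ δ = ε := by
  rw [isDesubstitution_iff] at hx hy
  obtain ⟨hx0, hx1, hx2⟩ := hx
  obtain ⟨hy0, hy1, hy2⟩ := hy
  have step : ∀ i, xs i = ys i → δ i = ε i ∧ xs (i + 1) = ys (i + 1) := by
    intro i h
    have h1 := (δ i).2
    have h2 := (ε i).2
    have := eq_of_onSeq_eq_shiftBy hτ hprim hinf (hx1 (i + 1)) (hy1 (i + 1))
      (e := ((δ i : ℕ) : ℤ) - (ε i : ℕ)) (by omega) (by omega) (by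
        rw [hx2, hy2] at h
        apply shiftBy_injective (ε i : ℕ)
        rw [← h, shiftBy_shiftBy]
        simp)
    exact ⟨Fin.ext (by omega), this.2⟩
  have hall : ∀ i, xs i = ys i := by
    intro i
    induction i with
    | zero => rw [hx0, hy0]
    | succ i ih => exact (step i ih).2
  exact ⟨funext hall, funext fun i => (step i (hall i)).1⟩

theorem exists_isDesubstitution (hprim : IsPrimitive τ) {x : ℤ → A} (hx : x ∈ subshift τ) :
    ∃ q : (ℕ → ℤ → A) × (ℕ → Fin p), IsDesubstitution τ x q.1 q.2 := by
  have h : ∀ x : subshift τ, ∃ (y : subshift τ) (r : Fin p),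
      x.1 = shiftBy (r : ℕ) (onSeq τ y.1) := by
    rintro ⟨x, hx⟩
    obtain ⟨y, hy, r, h⟩ := exists_desubst hprim hx
    exact ⟨⟨y, hy⟩, r, h⟩
  choose f r hfr using h
  refine ⟨⟨fun i => (f^[i] ⟨x, hx⟩).1, fun i => r (f^[i] ⟨x, hx⟩)⟩, ?_⟩
  rw [isDesubstitution_iff]
  refine ⟨rfl, fun i => (f^[i] ⟨x, hx⟩).2, fun i => ?_⟩
  simp only
  rw [Function.iterate_succ_apply']
  exact hfr _

variable [Nonempty A]

theorem isDesubstitution_level (hprim : IsPrimitive τ) {x : ℤ → A} (hx : x ∈ subshift τ) :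
    IsDesubstitution τ x (level τ x) (toOdometer τ x) :=
  Classical.epsilon_spec (exists_isDesubstitution hprim hx)

theorem IsDesubstitution.toOdometer_eq (hτ : Function.Injective τ) (hprim : IsPrimitive τ)
    (hinf : (subshift τ).Infinite) {x : ℤ → A} {xs : ℕ → ℤ → A} {δ : ℕ → Fin p}
    (h : IsDesubstitution τ x xs δ) : level τ x = xs ∧ toOdometer τ x = δ :=
  (isDesubstitution_level hprim (h.1 ▸ h.2.1 0)).unique hτ hprim hinf h

theorem toOdometer_shiftBy (hτ : Function.Injective τ) (hprim : IsPrimitive τ)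
    (hinf : (subshift τ).Infinite) {x : ℤ → A} (hx : x ∈ subshift τ) (k : ℕ) :
    toOdometer τ (shiftBy k x) = addDigits (toOdometer τ x) k :=
  (((isDesubstitution_level hprim hx).shiftBy_addDigits k).toOdometer_eq hτ hprim hinf).2

end Unique

/-! ### The set I⁺ and the shift by k⁺ -/

section IPlus

variable [Nonempty A]

theorem iPlus_eq (x : ℤ → A) : iPlus τ x = {i | (toOdometer τ x i : ℕ) ≠ p - 1} := by
  ext i
  have := (toOdometer τ x i).2
  simp only [iPlus, sWord, length_wordAt, Set.mem_ofPred_eq]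
  omega

theorem length_rightWord (x : ℤ → A) (i : ℕ) :
    (rightWord τ x i).length = reach (toOdometer τ x) (i + 1) := by
  simp only [rightWord, List.length_cons, List.length_flatMap, length_iterate_onWord, sWord,
    length_wordAt, reach]
  rw [add_comm, Finset.sum_eq_multiset_sum, Finset.range_val, Multiset.range,
    Multiset.map_coe, Multiset.sum_coe]
  simp [mul_comm]

/-- Digits equal to p - 1 add nothing to the reach, so it is constant beyond I⁺. If I⁺ is empty,
both sides are 1. -/
theorem kPlus_eq_reach {x : ℤ → A} (h : (iPlus τ x).Finite) {M : ℕ} (hM : ∀ i ∈ iPlus τ x, i < M) :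
    kPlus τ x = reach (toOdometer τ x) M := by
  simp only [kPlus, length_rightWord]
  apply le_antisymm
  · refine max_le (reach_pos _ _) (csSup_le' ?_)
    rintro _ ⟨i, hi, rfl⟩
    exact reach_mono _ (hM i hi)
  · clear hM
    induction M with
    | zero => exact le_max_left _ _
    | succ M ih =>
      by_cases hM : M ∈ iPlus τ x
      · exact le_max_of_le_right (le_csSup (h.image _).bddAbove ⟨M, hM, rfl⟩)
      · rw [iPlus_eq, Set.mem_ofPred_eq, not_not] at hM
        rwa [reach_succ, hM, Nat.sub_self, zero_mul, add_zero]

theorem addDigits_kPlus {x : ℤ → A} (h : (iPlus τ x).Finite) (i : ℕ) :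
    (addDigits (toOdometer τ x) (kPlus τ x) i : ℕ) = 0 := by
  obtain ⟨M, hM⟩ := h.bddAbove
  -- Any bound of I⁺ gives the same reach, so the bound may be taken beyond i; then digit i is among
  -- the cleared ones.
  rw [kPlus_eq_reach h (M := M + i + 1) fun j hj => by have := hM hj; omega]
  exact addDigits_reach _ (by omega)

theorem kPlus_congr {x y : ℤ → A} (h : toOdometer τ x = toOdometer τ y) :
    kPlus τ x = kPlus τ y := by
  simp only [kPlus, length_rightWord, iPlus_eq, h]

variable [TopologicalSpace A] [DiscreteTopology A] [Finite A]

theorem infinite_iPlus_shiftBy_kPlus (hp : 2 ≤ p) (hτ : Function.Injective τ)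
    (hprim : IsPrimitive τ) (hinf : (subshift τ).Infinite) {x : ℤ → A} (hx : x ∈ subshift τ)
    (h : (iPlus τ x).Finite) : (iPlus τ (shiftBy (kPlus τ x) x)).Infinite := by
  have : iPlus τ (shiftBy (kPlus τ x) x) = Set.univ := by
    ext i
    rw [iPlus_eq, toOdometer_shiftBy hτ hprim hinf hx]
    have := addDigits_kPlus h i
    simp only [Set.mem_ofPred_eq, this, Set.mem_univ, iff_true]
    omega
  rw [this]
  exact Set.infinite_univ

end IPlus

end Desubstitution

/-! ### Pairs of points in a fibre of the factor map -/

section Blocks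

variable {A : Type*} {p : ℕ} [NeZero p] {τ : A → Fin p → A}

theorem iterate_onSeq_const_ne (h : ∀ a b, a ≠ b → ∀ r, τ a r ≠ τ b r) (k : ℕ) {a b : A}
    (hab : a ≠ b) (n : ℤ) : (onSeq τ)^[k] (fun _ => a) n ≠ (onSeq τ)^[k] (fun _ => b) n := by
  induction k generalizing n with
  | zero => exact hab
  | succ k ih =>
    rw [Function.iterate_succ_apply', Function.iterate_succ_apply']
    exact h _ _ (ih _) _

/-- A difference at place pq + r forces r = r₀ and a difference at q one level up, so all k base-p
digits of the place equal r₀. -/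
theorem eq_of_iterate_onSeq_const_ne {r₀ : Fin p} (h : ∀ a b r, τ a r ≠ τ b r → r = r₀) (k : ℕ)
    {a b : A} {m n : ℤ} (hm : 0 ≤ m ∧ m < (p : ℤ) ^ k) (hn : 0 ≤ n ∧ n < (p : ℤ) ^ k)
    (hm' : (onSeq τ)^[k] (fun _ => a) m ≠ (onSeq τ)^[k] (fun _ => b) m)
    (hn' : (onSeq τ)^[k] (fun _ => a) n ≠ (onSeq τ)^[k] (fun _ => b) n) : m = n := by
  induction k generalizing m n with
  | zero => simp at hm hn; omega
  | succ k ih =>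
    have hp := natCast_pos_of_neZero (p := p)
    obtain ⟨q, r, rfl⟩ := exists_eq_mul_add (p := p) m
    obtain ⟨q', r', rfl⟩ := exists_eq_mul_add (p := p) n
    rw [Function.iterate_succ_apply', Function.iterate_succ_apply', onSeq_apply, onSeq_apply]
      at hm' hn'
    have hr := r.2
    have hr' := r'.2
    have hlt : ∀ (q : ℤ) (r : Fin p), 0 ≤ p * q + (r : ℕ) ∧ p * q + (r : ℕ) < (p : ℤ) ^ (k + 1) →
        0 ≤ q ∧ q < (p : ℤ) ^ k := by
      intro q r ⟨h1, h2⟩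
      have hr := r.2
      rw [pow_succ] at h2
      constructor
      · by_contra hq
        nlinarith
      · by_contra hq
        nlinarith
    have hq := ih (hlt q r hm) (hlt q' r' hn) (fun e => hm' (by rw [e])) (fun e => hn' (by rw [e]))
    rw [hq, h _ _ _ hm', h _ _ _ hn']

/-- The images of the constant sequences have period pᵏ. If they agreed on one period they would be
equal, against the injectivity of τ on sequences. -/
theorem exists_iterate_onSeq_const_ne (hτ : Function.Injective τ) (k : ℕ) {a b : A} (hab : a ≠ b) :
    ∃ n : ℤ, 0 ≤ n ∧ n < (p : ℤ) ^ k ∧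
      (onSeq τ)^[k] (fun _ => a) n ≠ (onSeq τ)^[k] (fun _ => b) n := by
  have hp := natCast_pos_of_neZero (p := p)
  by_contra! h
  have hpos : (0 : ℤ) < (p : ℤ) ^ k := by positivity
  have hper : ∀ (c : A) (n : ℤ),
      (onSeq τ)^[k] (fun _ => c) n = (onSeq τ)^[k] (fun _ => c) (n % (p : ℤ) ^ k) := by
    intro c n
    have := congrFun (iterate_onSeq_shiftBy τ k (fun _ => c) (n / (p : ℤ) ^ k)) (n % (p : ℤ) ^ k)
    rw [shiftBy_apply, Int.emod_add_mul_ediv] at this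
    rw [← this]
    rfl
  have : (fun _ : ℤ => a) = fun _ => b := by
    apply (onSeq_injective hτ).iterate k
    funext n
    rw [hper a, hper b]
    exact h _ (Int.emod_nonneg _ hpos.ne') (Int.emod_lt_of_pos _ hpos)
  exact hab (congrFun this 0)

end Blocks

/-! ### Comparison of two points with the same digits -/

section Fibre

variable {A : Type*} {p : ℕ} [NeZero p] {τ : A → Fin p → A} {x y : ℤ → A} {xs ys : ℕ → ℤ → A}
  {δ : ℕ → Fin p}

theorem IsDesubstitution.apply_eq_const (hx : IsDesubstitution τ x xs δ) (i : ℕ) (n : ℤ) :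
    x n = (onSeq τ)^[i] (fun _ => xs i ((n + offset δ i) / (p : ℤ) ^ i)) (n + offset δ i) := by
  rw [hx.apply_eq i, iterate_onSeq_eq_const]

theorem IsDesubstitution.apply_eq_zero (hx : IsDesubstitution τ x xs δ) {i n : ℕ}
    (hn : n < reach δ i) : x n = (onSeq τ)^[i] (fun _ => xs i 0) (n + offset δ i) := by
  rw [hx.apply_eq_const i, Int.ediv_eq_zero_of_lt (by positivity)]
  have := reach_add_offset δ i
  have h : n + offset δ i < p ^ i := by omega
  exact_mod_cast h

theorem IsDesubstitution.eq_of_level_eq (hx : IsDesubstitution τ x xs δ)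
    (hy : IsDesubstitution τ y ys δ) {i : ℕ} {q n : ℤ} (h : xs i q = ys i q)
    (h1 : (p : ℤ) ^ i * q ≤ n + offset δ i) (h2 : n + offset δ i < (p : ℤ) ^ i * (q + 1)) :
    x n = y n := by
  have hp := natCast_pos_of_neZero (p := p)
  have hpos : (0 : ℤ) < (p : ℤ) ^ i := by positivity
  have hq : (n + offset δ i) / (p : ℤ) ^ i = q :=
    (Int.ediv_eq_iff_of_pos hpos).2 ⟨by linarith, by linarith⟩
  rw [hx.apply_eq_const i, hy.apply_eq_const i, hq, h]

theorem IsDesubstitution.exists_ne_of_level_ne (hτ : Function.Injective τ)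
    (hx : IsDesubstitution τ x xs δ) (hy : IsDesubstitution τ y ys δ) {i : ℕ} {q : ℤ}
    (h : xs i q ≠ ys i q) : ∃ n : ℤ, (p : ℤ) ^ i * q ≤ n + offset δ i ∧ x n ≠ y n := by
  have hp := natCast_pos_of_neZero (p := p)
  obtain ⟨n, h0, h1, hne⟩ := exists_iterate_onSeq_const_ne hτ i h
  refine ⟨n + p ^ i * q - offset δ i, by linarith, ?_⟩
  rw [hx.apply_eq i, hy.apply_eq i, sub_add_cancel]
  have key : ∀ z : ℤ → A, (onSeq τ)^[i] z (n + p ^ i * q) = (onSeq τ)^[i] (fun _ => z q) n := by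
    intro z
    have := congrFun (iterate_onSeq_shiftBy τ i z q) n
    rw [shiftBy_apply] at this
    rw [← this, iterate_onSeq_eq_const, Int.ediv_eq_zero_of_lt h0 h1, shiftBy_apply, zero_add]
  rwa [key, key]

/-- At a high level the coordinates 0 and n lie in one block. Without coincidence, agreement at 0
forces the letters that generate the block to agree. -/
theorem IsDesubstitution.eq_of_zero_eq (hcoin : ∀ a b, a ≠ b → ∀ r, τ a r ≠ τ b r)
    (hx : IsDesubstitution τ x xs δ) (hy : IsDesubstitution τ y ys δ)
    (hδ : {i | (δ i : ℕ) ≠ p - 1}.Infinite) (h : x 0 = y 0) (n : ℕ) : x n = y n := by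
  obtain ⟨i, hi⟩ := exists_lt_reach hδ n
  have hi0 : xs i 0 = ys i 0 := by
    by_contra hne
    have h1 := hx.apply_eq_zero (reach_pos δ i)
    have h2 := hy.apply_eq_zero (reach_pos δ i)
    have := iterate_onSeq_const_ne hcoin i hne ((0 : ℕ) + offset δ i)
    rw [← h1, ← h2] at this
    exact this h
  rw [hx.apply_eq_zero hi, hy.apply_eq_zero hi, hi0]

theorem IsDesubstitution.ne_of_zero_ne (hcoin : ∀ a b, a ≠ b → ∀ r, τ a r ≠ τ b r)
    (hx : IsDesubstitution τ x xs δ) (hy : IsDesubstitution τ y ys δ)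
    (hδ : {i | (δ i : ℕ) ≠ p - 1}.Infinite) (h : x 0 ≠ y 0) (n : ℕ) : x n ≠ y n := by
  obtain ⟨i, hi⟩ := exists_lt_reach hδ n
  have hi0 : xs i 0 ≠ ys i 0 := by
    intro he
    have h1 := hx.apply_eq_zero (reach_pos δ i)
    have h2 := hy.apply_eq_zero (reach_pos δ i)
    rw [he, ← h2] at h1
    exact h h1
  rw [hx.apply_eq_zero hi, hy.apply_eq_zero hi]
  exact iterate_onSeq_const_ne hcoin i hi0 _

/-- Both places lie in one block of high level, where two images differ at most once. -/
theorem IsDesubstitution.eq_of_ne_of_ne {r₀ : Fin p} (huniq : ∀ a b r, τ a r ≠ τ b r → r = r₀)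
    (hx : IsDesubstitution τ x xs δ) (hy : IsDesubstitution τ y ys δ)
    (hδ : {i | (δ i : ℕ) ≠ p - 1}.Infinite) {m n : ℕ} (hm : x m ≠ y m) (hn : x n ≠ y n) :
    m = n := by
  obtain ⟨i, hi⟩ := exists_lt_reach hδ (max m n)
  have hmi : m < reach δ i := (le_max_left _ _).trans_lt hi
  have hni : n < reach δ i := (le_max_right _ _).trans_lt hi
  rw [hx.apply_eq_zero hmi, hy.apply_eq_zero hmi] at hm
  rw [hx.apply_eq_zero hni, hy.apply_eq_zero hni] at hn
  have := reach_add_offset δ i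
  have hb : ∀ n, n < reach δ i → (n + offset δ i : ℤ) < (p : ℤ) ^ i := by
    intro n hn
    have h : n + offset δ i < p ^ i := by omega
    exact_mod_cast h
  have := eq_of_iterate_onSeq_const_ne huniq i ⟨by positivity, hb m hmi⟩ ⟨by positivity, hb n hni⟩
    hm hn
  omega

/-- The words `s_i(x)` and `s_i(y)` differ infinitely often if and only if the right halves of `x`
and `y` do. -/
theorem IsDesubstitution.infinite_wordAt_ne_iff (hτ : Function.Injective τ)
    (hx : IsDesubstitution τ x xs δ) (hy : IsDesubstitution τ y ys δ)
    (hδ : {i | (δ i : ℕ) ≠ p - 1}.Infinite) :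
    {i | wordAt (xs i) 1 (p - 1 - (δ i : ℕ)) ≠ wordAt (ys i) 1 (p - 1 - (δ i : ℕ))}.Infinite ↔
      ∀ M : ℕ, ∃ n : ℕ, M ≤ n ∧ x n ≠ y n := by
  have hp := natCast_pos_of_neZero (p := p)
  simp only [ne_eq, wordAt_eq_iff, not_forall]
  constructor
  · intro h M
    obtain ⟨I, hI⟩ := eventually_atTop.1 ((tendsto_reach hδ).eventually_ge_atTop M)
    obtain ⟨i, ⟨k, hk, hne⟩, hi⟩ := h.exists_gt I
    obtain ⟨n, h1, hn⟩ := hx.exists_ne_of_level_ne hτ hy hne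
    have h2 := hI i hi.le
    have h3 := reach_add_offset δ i
    have h4 : (p : ℤ) ^ i ≤ (p : ℤ) ^ i * (1 + k) := by
      have : (0 : ℤ) ≤ (p : ℤ) ^ i * k := by positivity
      linarith
    have h5 : ((reach δ i : ℕ) : ℤ) + offset δ i = (p : ℤ) ^ i := by exact_mod_cast h3
    lift n to ℕ using by omega
    exact ⟨n, by omega, hn⟩
  · intro h
    refine Set.infinite_of_forall_exists_gt fun I => ?_
    obtain ⟨n, hn, hne⟩ := h (reach δ (I + 1))
    have hex := exists_lt_reach hδ n
    classical
    -- The least level whose block around the origin contains n is i + 1, so `reach δ i` ≤ n <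
    -- `reach δ (i + 1)` and n lies in the part τⁱ(s_i) of the tiling.
    obtain ⟨i, hi⟩ : ∃ i, Nat.find hex = i + 1 := by
      refine Nat.exists_eq_succ_of_ne_zero fun h0 => ?_
      have h1 := Nat.find_spec hex
      rw [h0] at h1
      have := reach_mono δ (Nat.zero_le (I + 1))
      omega
    have h1 := Nat.find_spec hex
    rw [hi] at h1
    have h2 : reach δ i ≤ n := not_lt.1 (Nat.find_min hex (by omega))
    have hIi : I < i := by
      by_contra hle
      have := reach_mono δ (show i + 1 ≤ I + 1 by omega)
      omega
    have h3 := reach_add_offset δ i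
    rw [reach_succ] at h1
    have hpos : 0 < p ^ i := Nat.pow_pos (by omega)
    have hq1 : 1 ≤ (n + offset δ i) / p ^ i := (Nat.one_le_div_iff hpos).2 (by omega)
    have hq2 : (n + offset δ i) / p ^ i < p - 1 - (δ i : ℕ) + 1 := by
      rw [Nat.div_lt_iff_lt_mul hpos, add_mul, one_mul]
      omega
    -- The quotient is the coordinate in x⁽ⁱ⁾; s_i starts at coordinate 1, hence the subtraction.
    refine ⟨i, ⟨(n + offset δ i) / p ^ i - 1, by omega, fun he => hne ?_⟩, hIi⟩
    have hcast : (1 : ℤ) + ((n + offset δ i) / p ^ i - 1 : ℕ) = ((n + offset δ i) / p ^ i : ℕ) := by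
      omega
    rw [hcast] at he
    refine hx.eq_of_level_eq hy he ?_ ?_
    · exact_mod_cast Nat.mul_div_le _ _
    · exact_mod_cast Nat.lt_mul_div_succ _ hpos

end Fibre

/-! ### Proximal pairs -/

section Proximal

variable {A : Type*}

/-- The sequences `x` and `y` agree on arbitrarily long windows arbitrarily far on the right. -/
def IsProximal (x y : ℤ → A) : Prop :=
  ∀ N : ℕ, ∃ n : ℕ, N ≤ n ∧ ∀ j : ℤ, |j| ≤ N → x (n + j) = y (n + j)

variable {p : ℕ} [NeZero p] {τ : A → Fin p → A} {x y : ℤ → A} {xs ys : ℕ → ℤ → A}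

theorem IsDesubstitution.isProximal {δ : ℕ → Fin p} (hp : 2 ≤ p) {r₀ : Fin p}
    (hcoin : ∀ a b, τ a r₀ = τ b r₀)
    (hx : IsDesubstitution τ x xs δ) (hy : IsDesubstitution τ y ys δ) : IsProximal x y := by
  intro N
  set i := 2 * N + 1 with hi
  have h1 := (δ i).2
  -- Coordinate t of x⁽ⁱ⁾ is the letter r₀ of τ(x⁽ⁱ⁺¹⁾₁), a coincidence. Using the block at 1 rather
  -- than at 0 makes t positive, so the common block of length pⁱ > 2N lies to the right of the
  -- origin.
  obtain ⟨t, ht⟩ : ∃ t : ℕ, t = p + r₀ - (δ i : ℕ) := ⟨_, rfl⟩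
  have ht1 : 1 ≤ t := by omega
  have heq : ∀ z : ℕ → ℤ → A, (∀ i, z i = shiftBy (δ i : ℕ) (onSeq τ (z (i + 1)))) →
      z i t = τ (z (i + 1) 1) r₀ := by
    intro z hz
    rw [← onSeq_apply τ (z (i + 1)), hz i, shiftBy_apply]
    congr 1
    omega
  have hlev : xs i t = ys i t := by
    rw [heq xs (isDesubstitution_iff.1 hx).2.2, heq ys (isDesubstitution_iff.1 hy).2.2]
    exact hcoin _ _
  have hpow : 2 * N + 1 ≤ p ^ i := by
    calc 2 * N + 1 ≤ 2 ^ i := by rw [← hi]; exact Nat.lt_two_pow_self.le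
      _ ≤ p ^ i := Nat.pow_le_pow_left hp i
  have hro := reach_add_offset δ i
  have htm : p ^ i ≤ p ^ i * t := Nat.le_mul_of_pos_right _ ht1
  refine ⟨p ^ i * t - offset δ i + N, by omega, fun j hj => ?_⟩
  rw [abs_le] at hj
  have hcast : ((p ^ i * t - offset δ i + N : ℕ) : ℤ) = (p : ℤ) ^ i * t - offset δ i + N := by
    rw [Nat.cast_add, Nat.cast_sub (by omega)]
    push_cast
    ring
  have hpow' : (2 * N + 1 : ℤ) ≤ (p : ℤ) ^ i := by exact_mod_cast hpow
  refine hx.eq_of_level_eq hy hlev ?_ ?_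
  · rw [hcast]; linarith
  · rw [hcast]; linarith

variable [TopologicalSpace A] [DiscreteTopology A] [Finite A]

/-- Distinct digits would shift one cutting against the other, which a bounded window detects
wherever it is placed. With equal digits, injectivity of τ passes agreement down to the preimages,
on windows shorter by a factor of about p. -/
theorem IsProximal.desubst (hτ : Function.Injective τ) (hprim : IsPrimitive τ)
    (hinf : (subshift τ).Infinite) {x y : ℤ → A} (hx : x ∈ subshift τ) (hy : y ∈ subshift τ)
    {k l : Fin p}
    (h : IsProximal (shiftBy (k : ℕ) (onSeq τ x)) (shiftBy (l : ℕ) (onSeq τ y))) :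
    k = l ∧ IsProximal x y := by
  have hp := natCast_pos_of_neZero (p := p)
  have hk := k.2
  have hl := l.2
  have hkl : k = l := by
    by_contra hne
    have hne' : ((l : ℕ) : ℤ) - (k : ℕ) ≠ 0 := by
      intro h0
      exact hne (Fin.ext (by omega))
    obtain ⟨N, hN⟩ := exists_window_shiftBy_onSeq_ne hτ hprim hinf
      (e := ((l : ℕ) : ℤ) - (k : ℕ)) (by omega) (by omega) hne'
    -- The margin p absorbs the displacement s < p from n + k to the start of its block.
    obtain ⟨n, -, hn⟩ := h (N + p)
    obtain ⟨q, s, hqs⟩ := exists_eq_mul_add (p := p) (n + (k : ℕ))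
    obtain ⟨j, hj, hjne⟩ := hN _ (shiftBy_mem_subshift hy q) _ (shiftBy_mem_subshift hx q)
    have hs := s.2
    apply hjne
    rw [abs_le] at hj
    have := hn (j - (s : ℕ)) (by rw [abs_le]; push_cast; omega)
    simp only [shiftBy_apply, onSeq_shiftBy] at this ⊢
    convert this.symm using 2 <;> omega
  refine ⟨hkl, ?_⟩
  subst hkl
  intro N
  obtain ⟨n, hn, hag⟩ := h (p * (N + 2))
  obtain ⟨q, s, hqs⟩ := exists_eq_mul_add (p := p) (n + (k : ℕ))
  have hs := s.2
  have hn' : (p : ℤ) * (N + 2) ≤ n := by exact_mod_cast hn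
  have hq : (N : ℤ) ≤ q := by
    by_contra hlt
    nlinarith
  lift q to ℕ using by omega
  refine ⟨q, by omega, fun j hj => hτ (funext fun r => ?_)⟩
  rw [abs_le] at hj
  have hr := r.2
  have h1 : (p : ℤ) * j ≤ p * N := by nlinarith
  have h2 : -((p : ℤ) * N) ≤ p * j := by nlinarith
  have hpos : (0 : ℤ) ≤ p * N := by positivity
  have := hag (p * j + (r : ℕ) - (s : ℕ)) (by
    rw [abs_le]
    push_cast
    constructor <;> nlinarith)
  simp only [shiftBy_apply] at this
  rw [show (n : ℤ) + (p * j + (r : ℕ) - (s : ℕ)) + (k : ℕ) = p * (q + j) + (r : ℕ) by linarith,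
    onSeq_apply, onSeq_apply] at this
  exact this

/-- Proximal points have the same image in the odometer. -/
theorem IsProximal.digits_eq (hτ : Function.Injective τ) (hprim : IsPrimitive τ)
    (hinf : (subshift τ).Infinite) {δ ε : ℕ → Fin p}
    (h : IsProximal x y) (hx : IsDesubstitution τ x xs δ) (hy : IsDesubstitution τ y ys ε) :
    δ = ε := by
  obtain ⟨hx0, hx1, hx2⟩ := isDesubstitution_iff.1 hx
  obtain ⟨hy0, hy1, hy2⟩ := isDesubstitution_iff.1 hy
  have step : ∀ i, IsProximal (xs i) (ys i) →
      δ i = ε i ∧ IsProximal (xs (i + 1)) (ys (i + 1)) := by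
    intro i hi
    rw [hx2 i, hy2 i] at hi
    exact hi.desubst hτ hprim hinf (hx1 _) (hy1 _)
  have hall : ∀ i, IsProximal (xs i) (ys i) := by
    intro i
    induction i with
    | zero => rwa [hx0, hy0]
    | succ i ih => exact (step i ih).2
  exact funext fun i => (step i (hall i)).1

end Proximal

/-! ### Metric properties of pairs in terms of coordinates -/

section Metric

variable {A X : Type*} [TopologicalSpace A] [DiscreteTopology A] [MetricSpace X] [CompactSpace X]
  {f : X → ℤ → A}

/-- Pairs at distance at least ε that agree on growing windows form decreasing compact sets; a
common element would be a pair u = v at positive distance. Together with `exists_agree_of_dist_lt`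
this makes the choice of the metric irrelevant. -/
theorem exists_dist_lt_of_agree (hf : Continuous f) (hinj : Function.Injective f) {ε : ℝ}
    (hε : 0 < ε) :
    ∃ N : ℕ, ∀ u v : X, (∀ j : ℤ, |j| ≤ N → f u j = f v j) → dist u v < ε := by
  by_contra! hcon
  let C : ℕ → Set (X × X) := fun N =>
    {q | ε ≤ dist q.1 q.2} ∩ ⋂ j ∈ {j : ℤ | |j| ≤ N}, {q | f q.1 j = f q.2 j}
  have hcl : ∀ N, IsClosed (C N) := fun N =>
    (isClosed_le continuous_const continuous_dist).inter <|
      isClosed_biInter fun j _ => isClosed_eq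
        ((continuous_apply j).comp (hf.comp continuous_fst))
        ((continuous_apply j).comp (hf.comp continuous_snd))
  obtain ⟨⟨u, v⟩, hq⟩ := IsCompact.nonempty_iInter_of_sequence_nonempty_isCompact_isClosed C
    (fun N => Set.inter_subset_inter_right _ (Set.biInter_subset_biInter_left fun j hj => by
      simp only [Set.mem_ofPred_eq] at hj ⊢; push_cast; omega))
    (fun N => by
      obtain ⟨u, v, h, hd⟩ := hcon N
      exact ⟨(u, v), hd, by simpa using h⟩)
    (hcl 0).isCompact hcl
  rw [Set.mem_iInter] at hq
  have huv : u = v := by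
    apply hinj
    funext j
    have := (hq j.natAbs).2
    simp only [Set.mem_iInter] at this
    exact this j (Int.abs_eq_natAbs j).le
  have : ε ≤ dist u v := (hq 0).1
  rw [huv, dist_self] at this
  exact absurd this hε.not_ge

/-- The pairs that differ in the window form a compact set off the diagonal, where the distance has
a positive minimum. -/
theorem exists_agree_of_dist_lt (hf : Continuous f) (N : ℕ) :
    ∃ ε > 0, ∀ u v : X, dist u v < ε → ∀ j : ℤ, |j| ≤ N → f u j = f v j := by
  set D : Set (X × X) := ⋃ j ∈ Set.Icc (-N : ℤ) N, {q | f q.1 j ≠ f q.2 j} with hD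
  have hcl : IsClosed D := by
    refine (Set.finite_Icc _ _).isClosed_biUnion fun j _ => ?_
    have hc : Continuous fun q : X × X => (f q.1 j, f q.2 j) :=
      ((continuous_apply j).comp (hf.comp continuous_fst)).prodMk
        ((continuous_apply j).comp (hf.comp continuous_snd))
    exact (isClosed_discrete {q : A × A | q.1 ≠ q.2}).preimage hc
  have hmem : ∀ u v : X, ∀ j : ℤ, |j| ≤ N → f u j ≠ f v j → (u, v) ∈ D := by
    intro u v j hj hne
    rw [hD, Set.mem_iUnion₂]
    exact ⟨j, abs_le.1 hj, hne⟩
  rcases D.eq_empty_or_nonempty with h0 | hne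
  · refine ⟨1, one_pos, fun u v _ j hj => ?_⟩
    by_contra hne
    have := hmem u v j hj hne
    rw [h0] at this
    exact this
  · obtain ⟨q, hq, hmin⟩ := hcl.isCompact.exists_isMinOn hne continuous_dist.continuousOn
    refine ⟨dist q.1 q.2, ?_, fun u v huv j hj => ?_⟩
    · rw [hD, Set.mem_iUnion₂] at hq
      obtain ⟨j, -, hj⟩ := hq
      exact dist_pos.2 fun h => hj (by rw [h])
    · by_contra hne
      exact absurd (hmin (hmem u v j hj hne)) (not_le.2 huv)

variable {T : X → X} {x y : X}

theorem isBoundedUnder_le_dist :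
    IsBoundedUnder (· ≤ ·) atTop fun n : ℕ => dist (T^[n] x) (T^[n] y) :=
  isBoundedUnder_of ⟨Metric.diam (Set.univ : Set X), fun _ =>
    Metric.dist_le_diam_of_mem isCompact_univ.isBounded (Set.mem_univ _) (Set.mem_univ _)⟩

omit [CompactSpace X] in
theorem isBoundedUnder_ge_dist :
    IsBoundedUnder (· ≥ ·) atTop fun n : ℕ => dist (T^[n] x) (T^[n] y) :=
  isBoundedUnder_of ⟨0, fun _ => dist_nonneg⟩

omit [CompactSpace X] in
theorem IsAsymptoticPair.not_isLiYorkePair (h : IsAsymptoticPair T x y) :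
    ¬ IsLiYorkePair T x y := fun h' => by
  have := h'.1
  rw [Tendsto.limsup_eq h] at this
  exact lt_irrefl _ this

omit [CompactSpace X] in
theorem IsDistalPair.not_isLiYorkePair (h : IsDistalPair T x y) : ¬ IsLiYorkePair T x y :=
  fun h' => h.ne' h'.2

section Coordinates

variable (hf : Continuous f) (hT : ∀ (n : ℕ) (u : X) (j : ℤ), f (T^[n] u) j = f u (n + j))

include hf hT

theorem isDistalPair_of_ne {M : ℕ} (h : ∀ n : ℕ, M ≤ n → f x n ≠ f y n) : IsDistalPair T x y := by
  obtain ⟨ε, hε, hag⟩ := exists_agree_of_dist_lt hf 0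
  refine hε.trans_le (le_liminf_of_le isBoundedUnder_le_dist.isCoboundedUnder_ge ?_)
  filter_upwards [eventually_ge_atTop M] with n hn
  by_contra! hlt
  apply h n hn
  simpa [hT] using hag _ _ hlt 0 (by simp)

theorem isAsymptoticPair_of_eq (hinj : Function.Injective f) {M : ℕ}
    (h : ∀ n : ℕ, M ≤ n → f x n = f y n) : IsAsymptoticPair T x y := by
  rw [IsAsymptoticPair, Metric.tendsto_atTop]
  intro ε hε
  obtain ⟨N, hN⟩ := exists_dist_lt_of_agree hf hinj hε
  refine ⟨M + N, fun n hn => ?_⟩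
  rw [Real.dist_0_eq_abs, abs_of_nonneg dist_nonneg]
  refine hN _ _ fun j hj => ?_
  rw [abs_le] at hj
  rw [hT, hT]
  obtain ⟨m, hm⟩ : ∃ m : ℕ, (n + j : ℤ) = m := ⟨(n + j).toNat, by omega⟩
  rw [hm]
  exact h m (by omega)

theorem IsLiYorkePair.isProximal (h : IsLiYorkePair T x y) : IsProximal (f x) (f y) := by
  intro N
  obtain ⟨ε, hε, hag⟩ := exists_agree_of_dist_lt hf N
  have hfr : ∃ᶠ n in atTop, dist (T^[n] x) (T^[n] y) < ε :=
    frequently_lt_of_liminf_lt isBoundedUnder_le_dist.isCoboundedUnder_ge (h.2 ▸ hε)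
  obtain ⟨n, hn, hlt⟩ := frequently_atTop.1 hfr N
  refine ⟨n, hn, fun j hj => ?_⟩
  rw [← hT, ← hT]
  exact hag _ _ hlt j hj

/-- Proximality makes the lower limit 0. A difference at one coordinate keeps the distance above a
fixed ε, and eventual agreement makes the pair asymptotic. -/
theorem isLiYorkePair_iff_of_isProximal (hinj : Function.Injective f)
    (h : IsProximal (f x) (f y)) :
    IsLiYorkePair T x y ↔ ∀ M : ℕ, ∃ n : ℕ, M ≤ n ∧ f x n ≠ f y n := by
  constructor
  · intro hLY
    by_contra! hcon
    obtain ⟨M, hM⟩ := hcon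
    exact (isAsymptoticPair_of_eq hf hT hinj hM).not_isLiYorkePair hLY
  · intro hne
    constructor
    · obtain ⟨ε, hε, hag⟩ := exists_agree_of_dist_lt hf 0
      refine hε.trans_le (le_limsup_of_frequently_le ?_ isBoundedUnder_le_dist)
      refine frequently_atTop.2 fun M => ?_
      obtain ⟨n, hn, hxy⟩ := hne M
      refine ⟨n, hn, ?_⟩
      by_contra! hlt
      apply hxy
      simpa [hT] using hag _ _ hlt 0 (by simp)
    · apply le_antisymm
      · refine le_of_forall_pos_le_add fun ε hε => ?_
        rw [zero_add]
        obtain ⟨N, hN⟩ := exists_dist_lt_of_agree hf hinj hε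
        refine liminf_le_of_frequently_le (frequently_atTop.2 fun M => ?_) isBoundedUnder_ge_dist
        obtain ⟨n, hn, hxy⟩ := h (max M N)
        refine ⟨n, (le_max_left _ _).trans hn, (hN _ _ fun j hj => ?_).le⟩
        rw [hT, hT]
        exact hxy j (hj.trans (by exact_mod_cast le_max_right M N))
      · exact le_liminf_of_le isBoundedUnder_le_dist.isCoboundedUnder_ge
          (Eventually.of_forall fun _ => dist_nonneg)

end Coordinates

end Metric

/-! ### Points with prescribed digits and prescribed letters at the origin -/

theorem frequently_ne_shiftBy_iff {A : Type*} {x y : ℤ → A} (k : ℕ) :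
    (∀ M : ℕ, ∃ n : ℕ, M ≤ n ∧ shiftBy k x n ≠ shiftBy k y n) ↔
      ∀ M : ℕ, ∃ n : ℕ, M ≤ n ∧ x n ≠ y n := by
  constructor
  · intro h M
    obtain ⟨n, hn, hne⟩ := h M
    exact ⟨n + k, by omega, by exact_mod_cast hne⟩
  · intro h M
    obtain ⟨n, hn, hne⟩ := h (M + k)
    obtain ⟨m, rfl⟩ := Nat.exists_eq_add_of_le' (show k ≤ n by omega)
    exact ⟨m, by omega, by exact_mod_cast hne⟩

theorem fin_two_ne_cases {a b : Fin 2} (h : a ≠ b) : a = 0 ∧ b = 1 ∨ a = 1 ∧ b = 0 := by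
  omega

section Construction

variable {A : Type*} [TopologicalSpace A] [DiscreteTopology A] [Finite A]
  {p : ℕ} [NeZero p] {τ : A → Fin p → A}

/-- The points with the required letters up to level i form nonempty compact sets that decrease by
`hc`; injectivity of τ makes the levels of a common point fit together. -/
theorem exists_isDesubstitution_const (hτ : Function.Injective τ) (hprim : IsPrimitive τ)
    (hne : (subshift τ).Nonempty) {a : Fin p} {c : ℕ → A} (hc : ∀ i, τ (c (i + 1)) a = c i) :
    ∃ (x : ℤ → A) (xs : ℕ → ℤ → A),
      IsDesubstitution τ x xs (fun _ => a) ∧ ∀ i, xs i 0 = c i := by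
  let F : ℕ → (ℤ → A) → ℤ → A := fun i u => shiftBy (offset (fun _ => a) i) ((onSeq τ)^[i] u)
  have hFsucc : ∀ i u, F (i + 1) u = F i (shiftBy (a : ℕ) (onSeq τ u)) := by
    intro i u
    simp only [F]
    rw [iterate_onSeq_shiftBy, shiftBy_shiftBy, Function.iterate_succ_apply, offset_succ]
    exact congrArg (fun k => shiftBy k _) (by push_cast; ring)
  have hFinj : ∀ i, Function.Injective (F i) := fun i =>
    (shiftBy_injective _).comp ((onSeq_injective hτ).iterate i)
  have hFcont : ∀ i, Continuous (F i) := fun i =>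
    (continuous_shiftBy _).comp ((continuous_onSeq τ).iterate i)
  let K : ℕ → Set (ℤ → A) := fun i => F i '' {u | u ∈ subshift τ ∧ u 0 = c i}
  have hco : ∀ i, IsCompact (K i) := fun i =>
    (((isClosed_subshift τ).inter
      (isClosed_eq (continuous_apply 0) continuous_const)).isCompact).image (hFcont i)
  obtain ⟨x₀, hx₀⟩ := hne
  obtain ⟨x, hx⟩ := IsCompact.nonempty_iInter_of_sequence_nonempty_isCompact_isClosed K
    (fun i => by
      rintro _ ⟨u, ⟨hu, hu0⟩, rfl⟩
      refine ⟨shiftBy (a : ℕ) (onSeq τ u),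
        ⟨shiftBy_mem_subshift (onSeq_mem_subshift hu) _, ?_⟩, (hFsucc i u).symm⟩
      have := onSeq_apply τ u 0 a
      rw [mul_zero, hu0, hc] at this
      exact this)
    (fun i => by
      obtain ⟨z, hz, h⟩ := exists_mem_subshift_zero hprim hx₀ (c i)
      exact ⟨_, z, ⟨hz, h⟩, rfl⟩)
    (hco 0) (fun i => (hco i).isClosed)
  rw [Set.mem_iInter] at hx
  choose xs hxs hxF using hx
  refine ⟨x, xs, isDesubstitution_iff.2 ⟨?_, fun i => (hxs i).1, fun i => ?_⟩, fun i => (hxs i).2⟩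
  · rw [← hxF 0]
    simp [F, offset]
  · apply hFinj i
    rw [← hFsucc, hxF, hxF]

/-- On a finite alphabet the injective map b ↦ τ(b)_a is a permutation, so two distinct letters can
be pulled back along it forever and stay distinct. -/
theorem exists_pair_isDesubstitution_const (hτ : Function.Injective τ) (hprim : IsPrimitive τ)
    (hne : (subshift τ).Nonempty) {a : Fin p} (ha : Function.Injective fun b => τ b a)
    {b c : A} (hbc : b ≠ c) :
    ∃ (x y : ℤ → A) (xs ys : ℕ → ℤ → A), IsDesubstitution τ x xs (fun _ => a) ∧
      IsDesubstitution τ y ys (fun _ => a) ∧ ∀ i, xs i 0 ≠ ys i 0 := by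
  let e : A ≃ A := Equiv.ofBijective _ (Finite.injective_iff_bijective.1 ha)
  have hchain : ∀ (b : A) (i : ℕ), τ (e.symm^[i + 1] b) a = e.symm^[i] b := by
    intro b i
    rw [Function.iterate_succ_apply']
    exact e.apply_symm_apply _
  obtain ⟨x, xs, hx, hx0⟩ := exists_isDesubstitution_const hτ hprim hne (c := fun i => e.symm^[i] b) (hchain b)
  obtain ⟨y, ys, hy, hy0⟩ := exists_isDesubstitution_const hτ hprim hne (c := fun i => e.symm^[i] c) (hchain c)
  refine ⟨x, y, xs, ys, hx, hy, fun i => ?_⟩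
  rw [hx0, hy0]
  exact (e.symm.injective.iterate i).ne hbc

variable [Nonempty A]

theorem infinite_sWord_ne_iff (hτ : Function.Injective τ) (hprim : IsPrimitive τ) {x y : ℤ → A}
    (hx : x ∈ subshift τ) (hy : y ∈ subshift τ) (h : toOdometer τ x = toOdometer τ y)
    (hI : (iPlus τ x).Infinite) :
    {i | sWord τ x i ≠ sWord τ y i}.Infinite ↔ ∀ M : ℕ, ∃ n : ℕ, M ≤ n ∧ x n ≠ y n := by
  rw [iPlus_eq] at hI
  have := (isDesubstitution_level hprim hx).infinite_wordAt_ne_iff hτ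
    (h ▸ isDesubstitution_level hprim hy) hI
  simpa only [sWord, ← h] using this

theorem exists_infinite_iPlus_shiftBy (hp : 2 ≤ p) (hτ : Function.Injective τ)
    (hprim : IsPrimitive τ) (hinf : (subshift τ).Infinite) {x : ℤ → A} (hx : x ∈ subshift τ) :
    ∃ k : ℕ, (iPlus τ (shiftBy k x)).Infinite := by
  by_cases h : (iPlus τ x).Finite
  · exact ⟨_, infinite_iPlus_shiftBy_kPlus hp hτ hprim hinf hx h⟩
  · exact ⟨0, by simpa using h⟩

end Construction

end ConstLengthSubst

/-! ### The theorem on pairs -/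

theorem corollary3p12 (p : ℕ) [NeZero p] (hp : 2 ≤ p)
    (τ : Fin 2 → Fin p → Fin 2)
    (hinj : Function.Injective τ)
    (hprim : IsPrimitive τ)
    (hinf : (subshift τ).Infinite)
    -- `ϱ` is any metric on `X_τ` that induces the topology of `X_τ` (as a subspace of `{0,1}^ℤ`)
    (ϱ : MetricSpace (subshift τ))
    (hϱ : ϱ.toPseudoMetricSpace.toUniformSpace.toTopologicalSpace =
      (instTopologicalSpaceSubtype : TopologicalSpace (subshift τ))) :
    -- (1) no coincidence
    (¬ HasCoincidence τ →
      ∀ x y : subshift τ, toOdometer τ x = toOdometer τ y →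
        ((∃ i : ℕ, x.1 i ≠ y.1 i ∧
            (iPlus τ ((shift τ)^[i] x)).Infinite ∧ (iPlus τ ((shift τ)^[i] y)).Infinite) →
          IsDistalPair (shift τ) x y) ∧
        ((¬ ∃ i : ℕ, x.1 i ≠ y.1 i ∧
            (iPlus τ ((shift τ)^[i] x)).Infinite ∧ (iPlus τ ((shift τ)^[i] y)).Infinite) →
          IsAsymptoticPair (shift τ) x y)) ∧
    -- (2) a unique non-coincidence
    ((∃! i : Fin p, τ 0 i ≠ τ 1 i) →
      ∀ x y : subshift τ, toOdometer τ x = toOdometer τ y →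
        IsAsymptoticPair (shift τ) x y) ∧
    -- (3) existence of Li–Yorke pairs
    ((∃ x y : subshift τ, IsLiYorkePair (shift τ) x y) ↔
      HasCoincidence τ ∧ ∃ i j : Fin p, i ≠ j ∧ τ 0 i ≠ τ 1 i ∧ τ 0 j ≠ τ 1 j) ∧
    -- (3) description of the Li–Yorke pairs in a fibre
    (HasCoincidence τ →
      ∀ x y : subshift τ, toOdometer τ x = toOdometer τ y →
        (IsLiYorkePair (shift τ) x y ↔
          ((iPlus τ x).Infinite ∧ {i : ℕ | sWord τ x i ≠ sWord τ y i}.Infinite) ∨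
          ((iPlus τ x).Finite ∧
            {i : ℕ | sWord τ ((shift τ)^[kPlus τ x] x) i ≠
              sWord τ ((shift τ)^[kPlus τ y] y) i}.Infinite))) := by
  have hcompact : @CompactSpace (subshift τ)
      ϱ.toPseudoMetricSpace.toUniformSpace.toTopologicalSpace := by
    rw [hϱ]
    exact isCompact_iff_compactSpace.1 (isCompact_subshift τ)
  have hf : @Continuous (subshift τ) (ℤ → Fin 2)
      ϱ.toPseudoMetricSpace.toUniformSpace.toTopologicalSpace _ Subtype.val := by
    rw [hϱ]
    exact continuous_subtype_val
  have hT : ∀ (n : ℕ) (u : subshift τ) (j : ℤ),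
      Subtype.val ((shift τ)^[n] u) j = Subtype.val u (n + j) := by
    intro n u j
    rw [shift_iterate_val, shiftBy_apply, add_comm]
  -- The fibres of the factor map are invariant.
  have hodo : ∀ x y : subshift τ, toOdometer τ x = toOdometer τ y → ∀ k : ℕ,
      toOdometer τ (shiftBy k x.1) = toOdometer τ (shiftBy k y.1) := by
    intro x y h k
    rw [toOdometer_shiftBy hinj hprim hinf x.2, toOdometer_shiftBy hinj hprim hinf y.2, h]
  have hdes : ∀ x y : subshift τ, toOdometer τ x = toOdometer τ y → ∀ k : ℕ,
      ∃ (xs ys : ℕ → ℤ → Fin 2) (δ : ℕ → Fin p),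
        IsDesubstitution τ (shiftBy k x.1) xs δ ∧ IsDesubstitution τ (shiftBy k y.1) ys δ ∧
        iPlus τ (shiftBy k x.1) = {i | (δ i : ℕ) ≠ p - 1} ∧
        iPlus τ (shiftBy k y.1) = {i | (δ i : ℕ) ≠ p - 1} := by
    intro x y h k
    have hx := isDesubstitution_level hprim (shiftBy_mem_subshift x.2 k)
    have hy := isDesubstitution_level hprim (shiftBy_mem_subshift y.2 k)
    rw [← hodo x y h k] at hy
    exact ⟨_, _, _, hx, hy, iPlus_eq _, by rw [iPlus_eq, hodo x y h k]⟩
  have hcoin_iff : HasCoincidence τ ↔ ∃ r, ∀ a b, τ a r = τ b r := by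
    constructor
    · rintro ⟨a, b, hab, r, hr⟩
      refine ⟨r, fun c d => ?_⟩
      by_cases hcd : c = d
      · rw [hcd]
      rcases fin_two_ne_cases hab with ⟨rfl, rfl⟩ | ⟨rfl, rfl⟩ <;>
        rcases fin_two_ne_cases hcd with ⟨rfl, rfl⟩ | ⟨rfl, rfl⟩
      exacts [hr, hr.symm, hr.symm, hr]
    · rintro ⟨r, hr⟩
      exact ⟨0, 1, by simp, r, hr 0 1⟩
  have part1 : ¬ HasCoincidence τ →
      ∀ x y : subshift τ, toOdometer τ x = toOdometer τ y →
        ((∃ i : ℕ, x.1 i ≠ y.1 i ∧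
            (iPlus τ ((shift τ)^[i] x)).Infinite ∧ (iPlus τ ((shift τ)^[i] y)).Infinite) →
          IsDistalPair (shift τ) x y) ∧
        ((¬ ∃ i : ℕ, x.1 i ≠ y.1 i ∧
            (iPlus τ ((shift τ)^[i] x)).Infinite ∧ (iPlus τ ((shift τ)^[i] y)).Infinite) →
          IsAsymptoticPair (shift τ) x y) := by
    intro hno x y h
    have hne : ∀ a b, a ≠ b → ∀ r, τ a r ≠ τ b r := fun a b hab r hr => hno ⟨a, b, hab, r, hr⟩
    simp only [shift_iterate_val]
    refine ⟨?_, fun hnot => ?_⟩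
    · rintro ⟨k, hk, hix, -⟩
      obtain ⟨xs, ys, δ, hx, hy, hIx, -⟩ := hdes x y h k
      refine isDistalPair_of_ne hf hT (M := k) fun n hn => ?_
      obtain ⟨m, rfl⟩ := Nat.exists_eq_add_of_le' hn
      have := hx.ne_of_zero_ne hne hy (hIx ▸ hix)
        (by rwa [shiftBy_apply, shiftBy_apply, zero_add]) m
      exact_mod_cast this
    · obtain ⟨k, hk⟩ := exists_infinite_iPlus_shiftBy hp hinj hprim hinf x.2
      obtain ⟨xs, ys, δ, hx, hy, hIx, hIy⟩ := hdes x y h k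
      have hk0 : x.1 k = y.1 k := by
        by_contra hne
        exact hnot ⟨k, hne, hk, by rwa [hIy, ← hIx]⟩
      refine isAsymptoticPair_of_eq hf hT Subtype.val_injective (M := k) fun n hn => ?_
      obtain ⟨m, rfl⟩ := Nat.exists_eq_add_of_le' hn
      have := hx.eq_of_zero_eq hne hy (hIx ▸ hk)
        (by rwa [shiftBy_apply, shiftBy_apply, zero_add]) m
      exact_mod_cast this
  have part2 : (∃! i : Fin p, τ 0 i ≠ τ 1 i) →
      ∀ x y : subshift τ, toOdometer τ x = toOdometer τ y →
        IsAsymptoticPair (shift τ) x y := by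
    rintro ⟨r₀, -, hr₀⟩ x y h
    have huniq : ∀ a b r, τ a r ≠ τ b r → r = r₀ := by
      intro a b r hr
      apply hr₀
      rcases fin_two_ne_cases (fun h => hr (by rw [h]) : a ≠ b) with ⟨rfl, rfl⟩ | ⟨rfl, rfl⟩
      exacts [hr, hr.symm]
    obtain ⟨k, hk⟩ := exists_infinite_iPlus_shiftBy hp hinj hprim hinf x.2
    obtain ⟨xs, ys, δ, hx, hy, hIx, -⟩ := hdes x y h k
    have hunique : ∀ m n : ℕ, shiftBy k x.1 m ≠ shiftBy k y.1 m →
        shiftBy k x.1 n ≠ shiftBy k y.1 n → m = n := fun m n hm hn =>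
      hx.eq_of_ne_of_ne huniq hy (hIx ▸ hk) hm hn
    obtain ⟨M, hM⟩ : ∃ M : ℕ, ∀ n : ℕ, M ≤ n → shiftBy k x.1 n = shiftBy k y.1 n := by
      by_cases hex : ∃ m : ℕ, shiftBy k x.1 m ≠ shiftBy k y.1 m
      · obtain ⟨m, hm⟩ := hex
        refine ⟨m + 1, fun n hn => ?_⟩
        by_contra hne
        have := hunique m n hm hne
        omega
      · push Not at hex
        exact ⟨0, fun n _ => hex n⟩
    refine isAsymptoticPair_of_eq hf hT Subtype.val_injective (M := M + k) fun n hn => ?_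
    obtain ⟨m, rfl⟩ := Nat.exists_eq_add_of_le' (show k ≤ n by omega)
    exact_mod_cast hM m (by omega)
  have hLY : HasCoincidence τ → ∀ x y : subshift τ, toOdometer τ x = toOdometer τ y →
      (IsLiYorkePair (shift τ) x y ↔ ∀ M : ℕ, ∃ n : ℕ, M ≤ n ∧ x.1 n ≠ y.1 n) := by
    intro hcoin x y h
    obtain ⟨r₀, hr₀⟩ := hcoin_iff.1 hcoin
    obtain ⟨xs, ys, δ, hx, hy, -⟩ := hdes x y h 0
    simp only [Nat.cast_zero, shiftBy_zero] at hx hy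
    exact isLiYorkePair_iff_of_isProximal hf hT Subtype.val_injective (hx.isProximal hp hr₀ hy)
  refine ⟨part1, part2, ⟨?_, ?_⟩, fun hcoin x y h => ?_⟩
  · rintro ⟨x, y, hxy⟩
    have h : toOdometer τ x = toOdometer τ y :=
      (hxy.isProximal hf hT).digits_eq hinj hprim hinf (isDesubstitution_level hprim x.2)
        (isDesubstitution_level hprim y.2)
    constructor
    · by_contra hno
      obtain ⟨hd, ha⟩ := part1 hno x y h
      by_cases hex : ∃ i : ℕ, x.1 i ≠ y.1 i ∧
          (iPlus τ ((shift τ)^[i] x)).Infinite ∧ (iPlus τ ((shift τ)^[i] y)).Infinite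
      · exact (hd hex).not_isLiYorkePair hxy
      · exact (ha hex).not_isLiYorkePair hxy
    · by_contra! hno
      obtain ⟨i, hi⟩ : ∃ i, τ 0 i ≠ τ 1 i := by
        by_contra! hall
        exact absurd (hinj (funext hall)) (by simp)
      refine (part2 ⟨i, hi, fun j hj => ?_⟩ x y h).not_isLiYorkePair hxy
      by_contra hne
      exact hj (hno i j (Ne.symm hne) hi)
  · rintro ⟨hcoin, hij⟩
    -- The smaller non-coincidence serves as the constant digit, so that j lies to the right of the
    -- origin in its block.
    obtain ⟨i, j, hlt, hi, hj⟩ : ∃ i j : Fin p, i < j ∧ τ 0 i ≠ τ 1 i ∧ τ 0 j ≠ τ 1 j := by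
      obtain ⟨i, j, hne, hi, hj⟩ := hij
      rcases lt_or_gt_of_ne hne with h | h
      · exact ⟨i, j, h, hi, hj⟩
      · exact ⟨j, i, h, hj, hi⟩
    have hinjAt : ∀ r, τ 0 r ≠ τ 1 r → Function.Injective fun b => τ b r := by
      intro r hr a b hab
      by_contra hne
      rcases fin_two_ne_cases hne with ⟨rfl, rfl⟩ | ⟨rfl, rfl⟩
      exacts [hr hab, hr hab.symm]
    obtain ⟨x, y, xs, ys, hx, hy, hne⟩ := exists_pair_isDesubstitution_const hinj hprim
      hinf.nonempty (hinjAt i hi) (zero_ne_one (α := Fin 2))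
    have hx1 := hx.toOdometer_eq hinj hprim hinf
    have hy1 := hy.toOdometer_eq hinj hprim hinf
    have hxX : x ∈ subshift τ := hx.1 ▸ hx.2.1 0
    have hyX : y ∈ subshift τ := hy.1 ▸ hy.2.1 0
    refine ⟨⟨x, hxX⟩, ⟨y, hyX⟩, (hLY hcoin _ _ (hx1.2.trans hy1.2.symm)).2 ?_⟩
    have hjp := j.2
    have hlt' : (i : ℕ) < j := hlt
    refine (hx.infinite_wordAt_ne_iff hinj hy ?_).1 ?_
    · refine Set.infinite_univ.mono fun _ _ => ?_
      simp only [Set.mem_ofPred_eq]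
      omega
    · refine Set.infinite_univ.mono fun n _ => ?_
      simp only [Set.mem_ofPred_eq, ne_eq, wordAt_eq_iff, not_forall]
      -- With δ_n = i, coordinate j - i of x⁽ⁿ⁾ is the letter j of τ(x⁽ⁿ⁺¹⁾₀). It belongs to s_n,
      -- and the non-coincidence j separates the two letters at 0.
      refine ⟨j - i - 1, by omega, fun he => hne (n + 1) (hinjAt j hj ?_)⟩
      have key : ∀ z : ℕ → ℤ → Fin 2, (∀ n, z n = shiftBy (i : ℕ) (onSeq τ (z (n + 1)))) →
          z n (1 + ((j - i - 1 : ℕ) : ℤ)) = τ (z (n + 1) 0) j := by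
        intro z hz
        rw [← onSeq_apply τ (z (n + 1)), hz n, shiftBy_apply]
        congr 1
        omega
      rw [key xs (isDesubstitution_iff.1 hx).2.2, key ys (isDesubstitution_iff.1 hy).2.2] at he
      exact he
  · rw [hLY hcoin x y h]
    by_cases hI : (iPlus τ x).Finite
    · have hk := infinite_iPlus_shiftBy_kPlus hp hinj hprim hinf x.2 hI
      rw [or_iff_right fun h' => h'.1 hI, and_iff_right hI, shift_iterate_val, shift_iterate_val,
        ← kPlus_congr h, infinite_sWord_ne_iff hinj hprim (shiftBy_mem_subshift x.2 _)
          (shiftBy_mem_subshift y.2 _) (hodo x y h _) hk, frequently_ne_shiftBy_iff]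
    · rw [or_iff_left fun h' => hI h'.1, and_iff_right (Set.not_finite.1 hI),
        infinite_sWord_ne_iff hinj hprim x.2 y.2 h hI]
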